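/- Let $K$ be a field of characteristic $0$ and let $\Lambda$ be the Hopf algebra of symmetric functions over $K$, i.e. the algebra of formal power series of bounded degree in $x_1,x_2,\dots$ that are invariant under all permutations of the variables, with the coproduct given by the algebra map $\Delta p_n=p_n\otimes 1+1\otimes p_n$ (where $p_n=\sum_i x_i^n$, $n\ge 1$) and with counit the constant term. For a partition $\lambda$ let $\widetilde m_\lambda=m_\lambda\cdot\prod_{i\ge 1} r_i(\lambda)!$, where $m_\lambda$ is the monomial symmetric function (the sum of all distinct monomials whose nonzero exponents are the parts of $\lambda$) and $r_i(\lambda)$ is the number of parts of $\lambda$ equal to $i$. Let $\widetilde\Lambda$ be the same vector space as $\Lambda$ with the same coproduct, counit and grading by degree, but with the product $\widetilde m_\lambda\odot\widetilde m_\mu=\widetilde m_{\lambda\sqcup\mu}$, where $\lambda\sqcup\mu$ has all the parts of $\lambda$ together with all the parts of $\mu$; it is again a Hopf algebra. A weighted graph $G$ is a finite simple graph with a positive integer weight $w(v)$ on each vertex $v$; its chromatic symmetric function is $X_G=\sum_\kappa\prod_{v}x_{\kappa(v)}^{w(v)}$, the sum over all proper colorings $\kappa$ of $G$ by positive integers,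 and $\overline G$ is the complement of $G$ with the same vertex weights. **Proposition.** Let $v_1,v_2,\dots$ be positive integers with $v_n\le n$ for every $n\ge 1$. Then the unique algebra homomorphism $\Lambda\to\widetilde\Lambda$ with $$p_n\mapsto \frac{(-1)^{v_n-1}}{(v_n-1)!}\,\widetilde m_n\qquad(n\ge 1)$$ is an isomorphism of graded Hopf algebras (it is bijective, preserves product, unit, coproduct and counit, and maps the degree $n$ part of $\Lambda$ onto the degree $n$ part of $\widetilde\Lambda$ for every $n\ge 0$). It sends $X_G$ to $X_{\overline G}$ for every weighted clique $G$ such that, for every $n\ge 1$, every induced subgraph of $G$ of total weight $n$ has exactly $v_n$ vertices. -/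

import Mathlib

noncomputable section

namespace SymmFun

open Finsupp
open scoped TensorProduct

/-- `f` has bounded degree. -/
def IsBoundedDegree {K : Type*} [Field K] (f : MvPowerSeries ℕ K) : Prop :=
  ∃ N : ℕ, ∀ d : ℕ →₀ ℕ, MvPowerSeries.coeff d f ≠ 0 → d.degree ≤ N

/-- `f` is invariant under all permutations of the variables. -/
def IsSymm {K : Type*} [Field K] (f : MvPowerSeries ℕ K) : Prop :=
  ∀ (σ : Equiv.Perm ℕ) (d : ℕ →₀ ℕ),
    MvPowerSeries.coeff (d.equivMapDomain σ) f = MvPowerSeries.coeff d f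

theorem degree_equivMapDomain (σ : Equiv.Perm ℕ) (d : ℕ →₀ ℕ) :
    (d.equivMapDomain σ).degree = d.degree := by
  rw [equivMapDomain_eq_mapDomain, degree_mapDomain]

theorem equivMapDomain_add (σ : Equiv.Perm ℕ) (d e : ℕ →₀ ℕ) :
    (d + e).equivMapDomain σ = d.equivMapDomain σ + e.equivMapDomain σ := by
  ext; simp

/-- The algebra `Λ` of symmetric functions over `K` in the variables `x_0, x_1, x_2, …`, as a
subalgebra of the algebra of formal power series. -/
def symmFun (K : Type*) [Field K] : Subalgebra K (MvPowerSeries ℕ K) where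
  carrier := {f | IsBoundedDegree f ∧ IsSymm f}
  mul_mem' := by
    rintro f g ⟨⟨N, hN⟩, hf⟩ ⟨⟨M, hM⟩, hg⟩
    refine ⟨⟨N + M, fun d hd => ?_⟩, fun σ d => ?_⟩
    · rw [MvPowerSeries.coeff_mul] at hd
      obtain ⟨p, hp, hp'⟩ := Finset.exists_ne_zero_of_sum_ne_zero hd
      rw [Finset.HasAntidiagonal.mem_antidiagonal] at hp
      rw [← hp, map_add]
      exact add_le_add (hN _ (left_ne_zero_of_mul hp')) (hM _ (right_ne_zero_of_mul hp'))
    · rw [MvPowerSeries.coeff_mul, MvPowerSeries.coeff_mul]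
      symm
      refine Finset.sum_bij' (fun p _ => (p.1.equivMapDomain σ, p.2.equivMapDomain σ))
        (fun p _ => (p.1.equivMapDomain σ.symm, p.2.equivMapDomain σ.symm)) ?_ ?_ ?_ ?_ ?_
      · intro p hp
        rw [Finset.HasAntidiagonal.mem_antidiagonal] at hp ⊢
        rw [← hp, equivMapDomain_add]
      · intro p hp
        rw [Finset.HasAntidiagonal.mem_antidiagonal] at hp ⊢
        rw [← equivMapDomain_add, hp]
        ext; simp
      · intro p _
        ext <;> simp
      · intro p _
        ext <;> simp
      · intro p _
        rw [hf, hg]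
  add_mem' := by
    rintro f g ⟨⟨N, hN⟩, hf⟩ ⟨⟨M, hM⟩, hg⟩
    refine ⟨⟨max N M, fun d hd => ?_⟩, fun σ d => ?_⟩
    · rw [map_add] at hd
      by_cases h : MvPowerSeries.coeff d f = 0
      · rw [h, zero_add] at hd
        exact le_max_of_le_right (hM d hd)
      · exact le_max_of_le_left (hN d h)
    · rw [map_add, map_add, hf, hg]
  algebraMap_mem' := by
    classical
    intro r
    refine ⟨⟨0, fun d hd => ?_⟩, fun σ d => ?_⟩
    · rw [MvPowerSeries.algebraMap_apply, MvPowerSeries.coeff_C] at hd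
      simp_all
    · rw [MvPowerSeries.algebraMap_apply, MvPowerSeries.coeff_C, MvPowerSeries.coeff_C]
      congr 1
      rw [← degree_eq_zero_iff, ← degree_eq_zero_iff, degree_equivMapDomain]

/-- The algebra `Λ` of symmetric functions over `K`, as a type. -/
abbrev Lam (K : Type*) [Field K] : Type _ := symmFun K

/-- The coefficient of the monomial `x^d` in a symmetric function. -/
def coeffL (K : Type*) [Field K] (d : ℕ →₀ ℕ) : Lam K →ₗ[K] K :=
  (MvPowerSeries.coeff d).comp (symmFun K).val.toLinearMap

theorem lam_ext {K : Type*} [Field K] {f g : Lam K} (h : ∀ d, coeffL K d f = coeffL K d g) :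
    f = g :=
  Subtype.ext (MvPowerSeries.ext h)

theorem coeffL_equivMapDomain {K : Type*} [Field K] (f : Lam K) (σ : Equiv.Perm ℕ)
    (d : ℕ →₀ ℕ) : coeffL K (d.equivMapDomain σ) f = coeffL K d f :=
  f.2.2 σ d

/-- The submodule of symmetric functions that are homogeneous of degree `n`. -/
def homogeneous (K : Type*) [Field K] (n : ℕ) : Submodule K (Lam K) where
  carrier := {f | ∀ d : ℕ →₀ ℕ, MvPowerSeries.coeff d f.1 ≠ 0 → d.degree = n}
  add_mem' := by
    intro f g hf hg d hd
    by_contra h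
    have h1 := not_not.1 (mt (hf d) h)
    have h2 := not_not.1 (mt (hg d) h)
    apply hd
    change MvPowerSeries.coeff d (f.1 + g.1) = 0
    rw [map_add, h1, h2, add_zero]
  zero_mem' := by
    intro d hd
    exact absurd (map_zero (MvPowerSeries.coeff d)) hd
  smul_mem' := by
    intro c f hf d hd
    apply hf d
    intro h
    apply hd
    change MvPowerSeries.coeff d (c • f.1) = 0
    rw [map_smul, h, smul_zero]

/-! Partitions are encoded by the multiplicities of their parts: `r : ℕ+ →₀ ℕ` is the partition
with `r i` parts equal to `i`, so the union of two partitions is the sum `r + s`. -/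

/-- The partition whose parts are the nonzero exponents of the monomial `x^d`. -/
def shape (d : ℕ →₀ ℕ) : ℕ+ →₀ ℕ :=
  ∑ i ∈ d.support, single (d i).toPNat' 1

/-- The product `∏ i, r_i!`. -/
def multFactorial (r : ℕ+ →₀ ℕ) : ℕ :=
  r.prod fun _ k => k.factorial

theorem shape_zero : shape 0 = 0 := by simp [shape]

theorem shape_add_single (d : ℕ →₀ ℕ) (i : ℕ) (hi : d i = 0) (k : ℕ+) :
    shape (d + single i (k : ℕ)) = shape d + single k 1 := by
  classical
  have hi' : i ∉ d.support := by simpa using hi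
  have hs : (d + single i (k : ℕ)).support = insert i d.support := by
    ext j
    by_cases h : j = i
    · subst h; simp [hi]
    · simp [h]
  rw [shape, hs, Finset.sum_insert hi', add_comm, shape]
  congr 1
  · refine Finset.sum_congr rfl fun j hj => ?_
    have : j ≠ i := fun h => hi' (h ▸ hj)
    simp [this]
  · simp [hi]

theorem exp_induction {P : (ℕ →₀ ℕ) → Prop} (h0 : P 0)
    (hs : ∀ (d : ℕ →₀ ℕ) (i : ℕ) (k : ℕ+), d i = 0 → P d → P (d + single i (k : ℕ))) (d) : P d := by
  refine Finsupp.induction d h0 fun i b d hi hb hd => ?_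
  have := hs d i ⟨b, Nat.pos_of_ne_zero hb⟩ (by simpa using hi) hd
  rwa [add_comm]

theorem part_induction {P : (ℕ+ →₀ ℕ) → Prop} (h0 : P 0)
    (hs : ∀ (r : ℕ+ →₀ ℕ) (k : ℕ+), P r → P (r + single k 1)) (r) : P r := by
  obtain ⟨m, rfl⟩ := Multiset.toFinsupp.surjective r
  induction m using Multiset.induction with
  | empty => simpa using h0
  | cons a m ih =>
    have := hs _ a ih
    rwa [← Multiset.toFinsupp_singleton, ← map_add, add_comm, Multiset.singleton_add] at this

theorem shape_equivMapDomain (σ : Equiv.Perm ℕ) (d : ℕ →₀ ℕ) :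
    shape (d.equivMapDomain σ) = shape d := by
  refine exp_induction (P := fun d => shape (d.equivMapDomain σ) = shape d) ?_ ?_ d
  · simp
  · intro d i k hi h
    rw [equivMapDomain_add, equivMapDomain_single, shape_add_single _ _ hi,
      shape_add_single _ _ (by simpa using hi), h]

theorem exists_single_of_shape {d : ℕ →₀ ℕ} {r : ℕ+ →₀ ℕ} {k : ℕ+}
    (h : shape d = r + single k 1) :
    ∃ (d' : ℕ →₀ ℕ) (i : ℕ), d' i = 0 ∧ d = d' + single i (k : ℕ) ∧ shape d' = r := by
  classical
  have h1 : shape d k ≠ 0 := by simp [h]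
  rw [shape, Finsupp.finsetSum_apply] at h1
  obtain ⟨i, hi, hi'⟩ := Finset.exists_ne_zero_of_sum_ne_zero h1
  have hk : (d i).toPNat' = k := by
    by_contra hne
    simp [hne] at hi'
  have hk' : d i = (k : ℕ) := by
    rw [← hk]
    have : d i ≠ 0 := by simpa using hi
    simp [Nat.pos_of_ne_zero this]
  have hd : d = d.erase i + single i (k : ℕ) := by
    rw [← hk', erase_add_single]
  refine ⟨d.erase i, i, by simp, hd, ?_⟩
  rw [hd, shape_add_single _ _ (by simp)] at h
  exact add_right_cancel h

theorem shape_eq_zero {d : ℕ →₀ ℕ} (h : shape d = 0) : d = 0 := by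
  revert h
  refine exp_induction (P := fun d => shape d = 0 → d = 0) (fun _ => rfl) ?_ d
  intro d i k hi _ h
  rw [shape_add_single _ _ hi] at h
  have := DFunLike.congr_fun h k
  simp at this

theorem exists_perm_of_shape_eq (d : ℕ →₀ ℕ) : ∀ e : ℕ →₀ ℕ, shape d = shape e →
    ∃ σ : Equiv.Perm ℕ, e = d.equivMapDomain σ := by
  refine exp_induction (P := fun d => ∀ e : ℕ →₀ ℕ, shape d = shape e →
    ∃ σ : Equiv.Perm ℕ, e = d.equivMapDomain σ) ?_ ?_ d
  · intro e h
    rw [shape_zero] at h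
    exact ⟨1, by rw [shape_eq_zero h.symm]; simp⟩
  · intro d i k hi ih e h
    rw [shape_add_single _ _ hi] at h
    obtain ⟨e', j, hj, rfl, he⟩ := exists_single_of_shape h.symm
    obtain ⟨σ, rfl⟩ := ih e' he.symm
    refine ⟨σ.trans (Equiv.swap (σ i) j), ?_⟩
    rw [equivMapDomain_add, equivMapDomain_single, Equiv.trans_apply, Equiv.swap_apply_left]
    congr 1
    ext l
    simp only [equivMapDomain_apply, Equiv.symm_trans_apply, Equiv.symm_swap] at hj ⊢
    by_cases h1 : l = σ i
    · subst h1; simp [hj, hi]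
    by_cases h2 : l = j
    · subst h2; simp [hj, hi]
    rw [Equiv.swap_apply_of_ne_of_ne h1 h2]

theorem exists_shape_eq (r : ℕ+ →₀ ℕ) : ∃ d : ℕ →₀ ℕ, shape d = r := by
  refine part_induction (P := fun r => ∃ d : ℕ →₀ ℕ, shape d = r) ⟨0, shape_zero⟩ ?_ r
  rintro r k ⟨d, rfl⟩
  obtain ⟨i, hi⟩ := Infinite.exists_notMem_finset d.support
  exact ⟨d + single i (k : ℕ), shape_add_single _ _ (by simpa using hi) _⟩

theorem degree_eq_of_shape (d : ℕ →₀ ℕ) : d.degree = (shape d).sum fun k m => m * (k : ℕ) := by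
  refine exp_induction (P := fun d => d.degree = (shape d).sum fun k m => m * (k : ℕ)) ?_ ?_ d
  · simp [shape_zero]
  · intro d i k hi h
    rw [shape_add_single _ _ hi, map_add, degree_single, h, Finsupp.sum_add_index']
    · simp
    · simp
    · intros; ring

theorem multFactorial_ne_zero (r : ℕ+ →₀ ℕ) : multFactorial r ≠ 0 :=
  Finset.prod_ne_zero_iff.2 fun _ _ => Nat.factorial_ne_zero _

theorem multFactorial_add_single (r : ℕ+ →₀ ℕ) (k : ℕ+) :
    multFactorial (r + single k 1) = (r k + 1) * multFactorial r := by
  classical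
  have h : ∀ s : ℕ+ →₀ ℕ, multFactorial s
      = ∏ i ∈ insert k r.support ∪ s.support, (s i).factorial := by
    intro s
    refine Finset.prod_subset Finset.subset_union_right fun i _ hi => ?_
    rw [Finsupp.notMem_support_iff] at hi
    simp [hi]
  have hs : (r + single k 1).support = insert k r.support := by
    ext j
    by_cases hj : j = k
    · subst hj; simp
    · simp [hj]
  rw [h r, h (r + _), hs, Finset.union_self,
    Finset.union_eq_left.2 (Finset.subset_insert _ _),
    ← Finset.mul_prod_erase _ _ (Finset.mem_insert_self k r.support),
    ← Finset.mul_prod_erase _ (fun i => (r i).factorial) (Finset.mem_insert_self k r.support),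
    ← mul_assoc]
  congr 1
  · simp [Nat.factorial_succ]
  · refine Finset.prod_congr rfl fun j hj => ?_
    simp [(Finset.ne_of_mem_erase hj)]

/-- The augmented monomial symmetric function `m̃_r = (∏ i, r_i!) m_r`, where the monomial symmetric
function `m_r` is the sum of all distinct monomials whose nonzero exponents are the parts of `r`. -/
def augMonomial (K : Type*) [Field K] (r : ℕ+ →₀ ℕ) : Lam K :=
  ⟨fun d => if shape d = r then (multFactorial r : K) else 0, by
    refine ⟨⟨r.sum fun k m => m * (k : ℕ), fun d hd => ?_⟩, fun σ d => ?_⟩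
    · rw [degree_eq_of_shape, of_not_not fun h => hd (if_neg h)]
    · change (if _ then _ else _) = (if _ then _ else _)
      rw [shape_equivMapDomain]⟩

theorem coeffL_augMonomial (K : Type*) [Field K] (r : ℕ+ →₀ ℕ) (d : ℕ →₀ ℕ) :
    coeffL K d (augMonomial K r) = if shape d = r then (multFactorial r : K) else 0 := rfl

open Classical in
/-- The power sum symmetric function `p_n = ∑ i, x_i ^ n`. -/
def psum (K : Type*) [Field K] (n : ℕ+) : Lam K :=
  ⟨fun d => if ∃ i, d = single i (n : ℕ) then 1 else 0, by
    refine ⟨⟨n, fun d hd => ?_⟩, fun σ d => ?_⟩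
    · obtain ⟨i, rfl⟩ := of_not_not fun h => hd (if_neg h)
      rw [degree_single]
    · refine if_congr ?_ rfl rfl
      refine ⟨?_, ?_⟩
      · rintro ⟨i, h⟩
        refine ⟨σ.symm i, ?_⟩
        have := congrArg (equivMapDomain σ.symm) h
        rw [equivMapDomain_single] at this
        rw [← this]
        ext; simp
      · rintro ⟨i, rfl⟩
        exact ⟨σ i, equivMapDomain_single _ _ _⟩⟩

theorem coeffL_psum_mul (K : Type*) [Field K] (n : ℕ+) (f : Lam K) (d : ℕ →₀ ℕ) :
    coeffL K d (psum K n * f)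
      = ∑ i ∈ d.support, if (n : ℕ) ≤ d i then coeffL K (d - single i (n : ℕ)) f else 0 := by
  classical
  change MvPowerSeries.coeff d ((psum K n).1 * f.1) = _
  rw [MvPowerSeries.coeff_mul, ← Finset.sum_filter]
  symm
  have hval : ∀ i, MvPowerSeries.coeff (single i (n : ℕ)) (psum K n).1 = 1 :=
    fun i => if_pos ⟨i, rfl⟩
  rw [← Finset.sum_filter_of_ne (p := fun p : (ℕ →₀ ℕ) × (ℕ →₀ ℕ) =>
    ∃ i, p.1 = single i (n : ℕ))]
  · refine Finset.sum_bij (fun i _ => (single i (n : ℕ), d - single i (n : ℕ))) ?_ ?_ ?_ ?_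
    · intro i hi
      rw [Finset.mem_filter] at hi ⊢
      refine ⟨?_, i, rfl⟩
      rw [Finset.HasAntidiagonal.mem_antidiagonal]
      exact add_tsub_cancel_of_le (by simpa using hi.2)
    · intro i _ j _ h
      exact Finsupp.single_left_injective n.ne_zero (Prod.ext_iff.1 h).1
    · rintro ⟨a, b⟩ h
      rw [Finset.mem_filter, Finset.HasAntidiagonal.mem_antidiagonal] at h
      obtain ⟨h1, i, h2⟩ := h
      simp only at h1 h2
      subst h2
      subst h1
      have := n.pos
      refine ⟨i, ?_, ?_⟩
      · rw [Finset.mem_filter, Finsupp.mem_support_iff, Finsupp.add_apply, Finsupp.single_eq_same]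
        omega
      · simp
    · intro i _
      rw [hval, one_mul]
      rfl
  · intro p _ hp
    by_contra h
    exact hp (by rw [show MvPowerSeries.coeff p.1 (psum K n).1 = 0 from if_neg h, zero_mul])

section Basis

variable (K : Type*) [Field K]

open MvPolynomial

/-- The linear map from polynomials in variables indexed by the positive integers to `Λ` sending the
monomial `X^r` to `m̃_r`. -/
def augMap : MvPolynomial ℕ+ K →ₗ[K] Lam K :=
  (basisMonomials ℕ+ K).constr K (augMonomial K)

theorem augMap_monomial (r : ℕ+ →₀ ℕ) (c : K) :
    augMap K (monomial r c) = c • augMonomial K r := by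
  have h : augMap K (monomial r 1) = augMonomial K r := by
    rw [augMap, show (monomial r (1 : K)) = basisMonomials ℕ+ K r by rw [coe_basisMonomials],
      Module.Basis.constr_basis]
  rw [← h, ← map_smul, smul_monomial, smul_eq_mul, mul_one]

theorem coeffL_augMap (d : ℕ →₀ ℕ) (f : MvPolynomial ℕ+ K) :
    coeffL K d (augMap K f) = multFactorial (shape d) * coeff (shape d) f := by
  induction f using MvPolynomial.induction_on' with
  | monomial r c =>
    rw [augMap_monomial, map_smul, coeffL_augMonomial, coeff_monomial, smul_eq_mul]
    by_cases h : shape d = r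
    · rw [if_pos h, if_pos h.symm, h, mul_comm]
    · rw [if_neg h, if_neg (Ne.symm h), mul_zero, mul_zero]
  | add p q hp hq => rw [map_add, map_add, coeff_add, hp, hq, mul_add]

theorem augMap_one : augMap K 1 = 1 := by
  classical
  refine lam_ext fun d => ?_
  rw [coeffL_augMap, coeff_one]
  change _ = MvPowerSeries.coeff d 1
  rw [MvPowerSeries.coeff_one]
  by_cases h : d = 0
  · subst h
    simp [shape_zero, multFactorial]
  · rw [if_neg h, if_neg (fun h' => h (shape_eq_zero h'.symm)), mul_zero]

/-- The derivation `X_k ↦ X_{k+n}`. -/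
def shiftD (n : ℕ+) : Derivation K (MvPolynomial ℕ+ K) (MvPolynomial ℕ+ K) :=
  mkDerivation K fun k => X (k + n)

/-- The operator on polynomials corresponding to multiplication by `p_n` on `Λ`. -/
def mulP (n : ℕ+) : MvPolynomial ℕ+ K →ₗ[K] MvPolynomial ℕ+ K :=
  LinearMap.mulLeft K (X n) + (shiftD K n).toLinearMap

theorem mulP_apply (n : ℕ+) (f : MvPolynomial ℕ+ K) : mulP K n f = X n * f + shiftD K n f := rfl

theorem coeffL_zero_augMap_mulP (n : ℕ+) (f : MvPolynomial ℕ+ K) :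
    coeffL K 0 (augMap K (mulP K n f)) = 0 := by
  classical
  rw [coeffL_augMap, shape_zero, ← constantCoeff_eq, mulP_apply, map_add, map_mul,
    constantCoeff_X, zero_mul, zero_add]
  refine mul_eq_zero_of_right _ ?_
  induction f using MvPolynomial.induction_on with
  | C a => rw [derivation_C, map_zero]
  | add p q hp hq => rw [map_add, map_add, hp, hq, add_zero]
  | mul_X p k hp =>
    rw [Derivation.leibniz, shiftD, mkDerivation_X, ← shiftD, smul_eq_mul, smul_eq_mul, map_add,
      map_mul, map_mul, hp, constantCoeff_X, mul_zero, mul_zero, add_zero]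

theorem coeffL_add_single_augMap (d : ℕ →₀ ℕ) (i : ℕ) (hi : d i = 0) (k : ℕ+)
    (f : MvPolynomial ℕ+ K) :
    coeffL K (d + single i (k : ℕ)) (augMap K f) = coeffL K d (augMap K (pderiv k f)) := by
  rw [coeffL_augMap, coeffL_augMap, shape_add_single _ _ hi, coeff_pderiv,
    multFactorial_add_single]
  push_cast
  ring

theorem pderiv_mulP (n k : ℕ+) (f : MvPolynomial ℕ+ K) :
    pderiv k (mulP K n f) = mulP K n (pderiv k f)
      + (if k = n then f else if n < k then pderiv (k - n) f else 0) := by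
  classical
  have hcomm : ⁅(pderiv k : Derivation K (MvPolynomial ℕ+ K) (MvPolynomial ℕ+ K)), shiftD K n⁆
      = if n < k then pderiv (k - n) else 0 := by
    refine derivation_ext fun m => ?_
    rw [Derivation.commutator_apply, shiftD, mkDerivation_X, pderiv_X, pderiv_X]
    have h0 : (mkDerivation K fun k => (X (k + n) : MvPolynomial ℕ+ K))
        (Pi.single (M := fun _ => MvPolynomial ℕ+ K) k 1 m) = 0 := by
      by_cases h : m = k
      · subst h; simp
      · simp [h]
    rw [h0, sub_zero]
    by_cases hk : n < k
    · rw [if_pos hk, pderiv_X]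
      by_cases h : m = k - n
      · have h' : m + n = k := by rw [h, PNat.sub_add_of_lt hk]
        rw [h', h]; simp
      · have h' : m + n ≠ k := by
          rintro rfl
          exact h (by rw [PNat.add_sub])
        rw [Pi.single_eq_of_ne h', Pi.single_eq_of_ne h]
    · have h' : m + n ≠ k := by
        rintro rfl
        exact hk (PNat.lt_add_left _ _)
      rw [if_neg hk, Pi.single_eq_of_ne h']
      rfl
  have h1 : pderiv k (shiftD K n f) = shiftD K n (pderiv k f)
      + (if n < k then pderiv (k - n) f else 0) := by
    have := congrArg (fun D : Derivation K _ _ => D f) hcomm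
    simp only [Derivation.commutator_apply] at this
    rw [sub_eq_iff_eq_add'] at this
    rw [this]
    congr 1
    split_ifs <;> rfl
  rw [mulP_apply, mulP_apply, map_add, pderiv_mul, h1, pderiv_X]
  by_cases h : k = n
  · subst h
    simp
    ring
  · rw [if_neg h, Pi.single_eq_of_ne (Ne.symm h)]
    ring

theorem coeffL_augMap_mulP (n : ℕ+) (d : ℕ →₀ ℕ) : ∀ f : MvPolynomial ℕ+ K,
    coeffL K d (augMap K (mulP K n f)) = ∑ i ∈ d.support,
      if (n : ℕ) ≤ d i then coeffL K (d - single i (n : ℕ)) (augMap K f) else 0 := by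
  classical
  refine exp_induction (P := fun d => ∀ f : MvPolynomial ℕ+ K,
    coeffL K d (augMap K (mulP K n f)) = ∑ i ∈ d.support,
      if (n : ℕ) ≤ d i then coeffL K (d - single i (n : ℕ)) (augMap K f) else 0) ?_ ?_ d
  · intro f
    rw [coeffL_zero_augMap_mulP]
    simp
  · intro d i k hi ih f
    have hi' : i ∉ d.support := by simpa using hi
    have hs : (d + single i (k : ℕ)).support = insert i d.support := by
      ext j
      by_cases h : j = i
      · subst h; simp [hi]
      · simp [h]
    rw [coeffL_add_single_augMap _ _ _ hi, pderiv_mulP, map_add, map_add, ih, hs,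
      Finset.sum_insert hi', add_comm]
    congr 1
    · have h0 : (d + single i (k : ℕ)) i = k := by simp [hi]
      rw [h0]
      rcases lt_trichotomy k n with h | h | h
      · rw [if_neg h.ne, if_neg h.not_gt, if_neg (by simpa using h), map_zero, map_zero]
      · subst h
        rw [if_pos rfl, if_pos le_rfl, add_tsub_cancel_right]
      · rw [if_neg h.ne', if_pos h, if_pos (by simpa using h.le)]
        have h1 : d + single i (k : ℕ) - single i (n : ℕ)
            = d + single i ((k - n : ℕ+) : ℕ) := by
          ext j
          by_cases hj : j = i
          · subst hj
            simp [hi, PNat.sub_coe, h]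
          · simp [hj]
        rw [h1, coeffL_add_single_augMap _ _ _ hi]
    · refine Finset.sum_congr rfl fun j hj => ?_
      have hji : j ≠ i := fun h => hi' (h ▸ hj)
      have h0 : (d + single i (k : ℕ)) j = d j := by simp [hji]
      rw [h0]
      by_cases hn : (n : ℕ) ≤ d j
      · rw [if_pos hn, if_pos hn]
        have h1 : d + single i (k : ℕ) - single j (n : ℕ)
            = d - single j (n : ℕ) + single i (k : ℕ) := by
          ext l
          by_cases hl : l = i
          · subst hl
            simp [hi, hji]
          · simp [hl]
        rw [h1, coeffL_add_single_augMap _ _ _ (by simp [hi])]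
      · rw [if_neg hn, if_neg hn]

theorem augMap_mulP (n : ℕ+) (f : MvPolynomial ℕ+ K) :
    augMap K (mulP K n f) = psum K n * augMap K f :=
  lam_ext fun d => by rw [coeffL_augMap_mulP, coeffL_psum_mul]

variable [CharZero K]

theorem augMap_injective : Function.Injective (augMap K) := by
  rw [injective_iff_map_eq_zero]
  intro f hf
  ext r
  obtain ⟨d, rfl⟩ := exists_shape_eq r
  have h := coeffL_augMap K d f
  rw [hf, map_zero] at h
  have h2 : (multFactorial (shape d) : K) ≠ 0 := Nat.cast_ne_zero.2 (multFactorial_ne_zero _)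
  simpa [h2] using h.symm

theorem augMap_surjective : Function.Surjective (augMap K) := by
  classical
  intro f
  obtain ⟨N, hN⟩ := f.2.1
  choose rep hrep using exists_shape_eq
  let F : Finset (ℕ+ →₀ ℕ) := (Finset.Icc 1 N.succPNat).finsupp fun _ => Finset.range (N + 1)
  refine ⟨∑ r ∈ F, monomial r (coeffL K (rep r) f / multFactorial r), lam_ext fun d => ?_⟩
  rw [coeffL_augMap]
  have hc : coeff (shape d) (∑ r ∈ F, monomial r (coeffL K (rep r) f / (multFactorial r : K)))
      = if shape d ∈ F then coeffL K (rep (shape d)) f / (multFactorial (shape d) : K) else 0 := by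
    rw [coeff_sum]
    simp only [coeff_monomial]
    rw [Finset.sum_ite_eq']
  have h2 : (multFactorial (shape d) : K) ≠ 0 := Nat.cast_ne_zero.2 (multFactorial_ne_zero _)
  have h3 : coeffL K (rep (shape d)) f = coeffL K d f := by
    obtain ⟨σ, hσ⟩ := exists_perm_of_shape_eq d (rep (shape d)) (hrep _).symm
    rw [hσ, coeffL_equivMapDomain]
  rw [hc]
  by_cases hF : shape d ∈ F
  · rw [if_pos hF, mul_div_cancel₀ _ h2, h3]
  · rw [if_neg hF, mul_zero]
    by_contra h
    apply hF
    have hd : d.degree ≤ N := hN d (Ne.symm h)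
    rw [degree_eq_of_shape] at hd
    have hle : ∀ k ∈ (shape d).support, shape d k * (k : ℕ) ≤ N := fun k hk =>
      (Finset.single_le_sum (f := fun k => shape d k * (k : ℕ)) (fun _ _ => Nat.zero_le _) hk).trans
        hd
    rw [Finset.mem_finsupp_iff]
    refine ⟨fun k hk => ?_, fun k _ => ?_⟩
    · rw [Finset.mem_Icc]
      refine ⟨one_le, ?_⟩
      rw [← PNat.coe_le_coe, Nat.succPNat_coe]
      have h4 := hle k hk
      have h5 : 1 ≤ shape d k := Nat.one_le_iff_ne_zero.2 (by simpa using hk)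
      nlinarith
    · rw [Finset.mem_range]
      by_cases hk : k ∈ (shape d).support
      · have h4 := hle k hk
        have h5 : 1 ≤ k := one_le
        rw [← PNat.coe_le_coe] at h5
        simp only [PNat.one_coe] at h5
        nlinarith
      · rw [Finsupp.notMem_support_iff.1 hk]
        omega

/-- The augmented monomial symmetric functions form a basis of `Λ`. -/
def augEquiv : MvPolynomial ℕ+ K ≃ₗ[K] Lam K :=
  LinearEquiv.ofBijective (augMap K) ⟨augMap_injective K, augMap_surjective K⟩

theorem augEquiv_apply (f : MvPolynomial ℕ+ K) : augEquiv K f = augMap K f := rfl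

theorem augEquiv_monomial (r : ℕ+ →₀ ℕ) : augEquiv K (monomial r 1) = augMonomial K r := by
  rw [augEquiv_apply, augMap_monomial, one_smul]

end Basis

section Generators

variable (K : Type*) [Field K]

open MvPolynomial

/-- Polynomials all of whose monomials have degree less than `N`. -/
def degLt (N : ℕ) : Submodule K (MvPolynomial ℕ+ K) := restrictSupport K {s | s.degree < N}

theorem monomial_mem_degLt (s : ℕ+ →₀ ℕ) (c : K) (N : ℕ) (h : s.degree < N) :
    monomial s c ∈ degLt K N := (monomial_mem_restrictSupport K).2 (Or.inl h)

theorem degLt_mono {N M : ℕ} (h : N ≤ M) : degLt K N ≤ degLt K M :=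
  restrictSupport_mono K fun _ hs => lt_of_lt_of_le hs h

theorem degLt_le_of_monomial {N : ℕ} (W : Submodule K (MvPolynomial ℕ+ K))
    (h : ∀ s : ℕ+ →₀ ℕ, s.degree < N → monomial s 1 ∈ W) : degLt K N ≤ W := by
  rw [degLt, restrictSupport_eq_span, Submodule.span_le]
  rintro _ ⟨s, hs, rfl⟩
  exact h s hs

theorem X_mul_mem_degLt (n : ℕ+) {N : ℕ} {f : MvPolynomial ℕ+ K} (hf : f ∈ degLt K N) :
    X n * f ∈ degLt K (N + 1) := by
  refine degLt_le_of_monomial K ((degLt K (N + 1)).comap (LinearMap.mulLeft K (X n))) ?_ hf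
  intro s hs
  rw [Submodule.mem_comap, LinearMap.mulLeft_apply, X, monomial_mul]
  refine monomial_mem_degLt K _ _ _ ?_
  rw [map_add, degree_single]
  omega

theorem shiftD_mem_degLt (n : ℕ+) {N : ℕ} {f : MvPolynomial ℕ+ K} (hf : f ∈ degLt K N) :
    shiftD K n f ∈ degLt K N := by
  refine degLt_le_of_monomial K ((degLt K N).comap (shiftD K n).toLinearMap) ?_ hf
  intro s hs
  change shiftD K n (monomial s 1) ∈ degLt K N
  rw [shiftD, mkDerivation_monomial, one_smul]
  refine Submodule.sum_mem _ fun k hk => ?_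
  change monomial (s - single k 1) (s k : K) * X (k + n) ∈ degLt K N
  rw [X, monomial_mul]
  refine monomial_mem_degLt K _ _ _ (lt_of_le_of_lt (le_of_eq ?_) hs)
  have h : single k 1 ≤ s := by
    rw [Finsupp.single_le_iff]
    exact Nat.one_le_iff_ne_zero.2 (by simpa using hk)
  conv_rhs => rw [← tsub_add_cancel_of_le h]
  rw [map_add, map_add, degree_single, degree_single]

/-- The algebra map from polynomials to `Λ` sending `X_n` to `p_n`. -/
def psumHom : MvPolynomial ℕ+ K →ₐ[K] Lam K := aeval (psum K)

theorem degLt_zero {f : MvPolynomial ℕ+ K} (hf : f ∈ degLt K 0) : f = 0 := by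
  have := degLt_le_of_monomial K (N := 0) ⊥ (fun s hs => absurd hs (Nat.not_lt_zero _)) hf
  simpa using this

theorem exists_mem_degLt (f : MvPolynomial ℕ+ K) : ∃ N, f ∈ degLt K N :=
  ⟨f.support.sup (fun s => s.degree) + 1, fun _ hs =>
    Nat.lt_succ_of_le (Finset.le_sup (f := fun s => s.degree) hs)⟩

variable [CharZero K]

/-- The map `psumHom` read in the basis of augmented monomial symmetric functions. -/
def psumToAug : MvPolynomial ℕ+ K →ₗ[K] MvPolynomial ℕ+ K :=
  (augEquiv K).symm.toLinearMap ∘ₗ (psumHom K).toLinearMap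

theorem augEquiv_psumToAug (f : MvPolynomial ℕ+ K) :
    augEquiv K (psumToAug K f) = psumHom K f := by simp [psumToAug]

theorem psumToAug_one : psumToAug K 1 = 1 := by
  apply (augEquiv K).injective
  rw [augEquiv_psumToAug, map_one, augEquiv_apply, augMap_one]

theorem psumToAug_X_mul (n : ℕ+) (f : MvPolynomial ℕ+ K) :
    psumToAug K (X n * f) = mulP K n (psumToAug K f) := by
  apply (augEquiv K).injective
  rw [augEquiv_psumToAug, map_mul, augEquiv_apply, augMap_mulP, ← augEquiv_apply,
    augEquiv_psumToAug, psumHom, aeval_X]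

theorem psumToAug_monomial_sub_mem (s : ℕ+ →₀ ℕ) :
    psumToAug K (monomial s 1) - monomial s 1 ∈ degLt K s.degree := by
  refine part_induction (P := fun s => psumToAug K (monomial s 1) - monomial s 1
    ∈ degLt K s.degree) ?_ ?_ s
  · rw [show (monomial (0 : ℕ+ →₀ ℕ) (1 : K)) = 1 from rfl, psumToAug_one, sub_self]
    exact Submodule.zero_mem _
  · intro s k h
    have hs : monomial (s + single k 1) (1 : K) = X k * monomial s 1 := by
      rw [X, monomial_mul, add_comm, one_mul]
    rw [hs, psumToAug_X_mul, mulP_apply, map_add, degree_single, add_sub_right_comm, ← mul_sub]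
    refine Submodule.add_mem _ (X_mul_mem_degLt K k h) (shiftD_mem_degLt K k ?_)
    rw [← sub_add_cancel (psumToAug K (monomial s 1)) (monomial s 1)]
    exact Submodule.add_mem _ (degLt_mono K (Nat.le_succ _) h)
      (monomial_mem_degLt K _ _ _ (Nat.lt_succ_self _))

theorem psumToAug_sub_mem {N : ℕ} {f : MvPolynomial ℕ+ K} (hf : f ∈ degLt K (N + 1)) :
    psumToAug K f - f ∈ degLt K N := by
  have h : degLt K (N + 1) ≤ (degLt K N).comap (psumToAug K - LinearMap.id) := by
    refine degLt_le_of_monomial K _ fun s hs => ?_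
    rw [Submodule.mem_comap, LinearMap.sub_apply, LinearMap.id_apply]
    exact degLt_mono K (Nat.lt_succ_iff.1 hs) (psumToAug_monomial_sub_mem K s)
  have h2 := h hf
  rwa [Submodule.mem_comap, LinearMap.sub_apply, LinearMap.id_apply] at h2

theorem psumToAug_injective : Function.Injective (psumToAug K) := by
  rw [injective_iff_map_eq_zero]
  intro f hf
  obtain ⟨N, hN⟩ := exists_mem_degLt K f
  induction N with
  | zero => exact degLt_zero K hN
  | succ N ih =>
    have := psumToAug_sub_mem K hN
    rw [hf, zero_sub] at this
    exact ih ((Submodule.neg_mem_iff _).1 this)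

theorem psumToAug_surjective : Function.Surjective (psumToAug K) := by
  intro f
  obtain ⟨N, hN⟩ := exists_mem_degLt K f
  induction N generalizing f with
  | zero => exact ⟨0, by rw [degLt_zero K hN, map_zero]⟩
  | succ N ih =>
    obtain ⟨g, hg⟩ := ih _ (psumToAug_sub_mem K hN)
    exact ⟨f - g, by rw [map_sub, hg, sub_sub_cancel]⟩

theorem psumHom_bijective : Function.Bijective (psumHom K) := by
  have h : ⇑(psumHom K) = augEquiv K ∘ psumToAug K := by
    ext f
    rw [Function.comp_apply, augEquiv_psumToAug]
  rw [h]
  exact (augEquiv K).bijective.comp ⟨psumToAug_injective K, psumToAug_surjective K⟩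

/-- The power sums `p_1, p_2, …` are algebraically independent generators of `Λ`. -/
def psumEquiv : MvPolynomial ℕ+ K ≃ₐ[K] Lam K :=
  AlgEquiv.ofBijective (psumHom K) (psumHom_bijective K)

theorem psumEquiv_apply (f : MvPolynomial ℕ+ K) : psumEquiv K f = psumHom K f := rfl

theorem psumEquiv_X (n : ℕ+) : psumEquiv K (X n) = psum K n := by
  rw [psumEquiv_apply, psumHom, aeval_X]

theorem psumEquiv_symm_psum (n : ℕ+) : (psumEquiv K).symm (psum K n) = X n := by
  rw [← psumEquiv_X, AlgEquiv.symm_apply_apply]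

theorem lam_algHom_ext {B : Type*} [Semiring B] [Algebra K B] {f g : Lam K →ₐ[K] B}
    (h : ∀ n, f (psum K n) = g (psum K n)) : f = g := by
  have h1 : f.comp (psumEquiv K : MvPolynomial ℕ+ K →ₐ[K] Lam K)
      = g.comp (psumEquiv K : MvPolynomial ℕ+ K →ₐ[K] Lam K) := by
    refine MvPolynomial.algHom_ext fun n => ?_
    change f (psumEquiv K (X n)) = g (psumEquiv K (X n))
    rw [psumEquiv_X, h]
  ext x
  have := DFunLike.congr_fun h1 ((psumEquiv K).symm x)
  simpa using this

/-! ### The Hopf algebra `Λ` -/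

/-- The coproduct of `Λ`: the algebra map with `p_n ↦ p_n ⊗ 1 + 1 ⊗ p_n`. -/
def comulHom : Lam K →ₐ[K] Lam K ⊗[K] Lam K :=
  (aeval fun n => psum K n ⊗ₜ[K] 1 + 1 ⊗ₜ[K] psum K n).comp
    ((psumEquiv K).symm : Lam K →ₐ[K] MvPolynomial ℕ+ K)

theorem comulHom_psum (n : ℕ+) :
    comulHom K (psum K n) = psum K n ⊗ₜ[K] 1 + 1 ⊗ₜ[K] psum K n := by
  rw [comulHom, AlgHom.comp_apply]
  change aeval _ ((psumEquiv K).symm (psum K n)) = _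
  rw [psumEquiv_symm_psum, aeval_X]

/-- The antipode of `Λ`: the algebra map with `p_n ↦ -p_n`. -/
def antipodeHom : Lam K →ₐ[K] Lam K :=
  (aeval fun n => -psum K n).comp ((psumEquiv K).symm : Lam K →ₐ[K] MvPolynomial ℕ+ K)

theorem antipodeHom_psum (n : ℕ+) : antipodeHom K (psum K n) = -psum K n := by
  rw [antipodeHom, AlgHom.comp_apply]
  change aeval _ ((psumEquiv K).symm (psum K n)) = _
  rw [psumEquiv_symm_psum, aeval_X]

end Generators

section Counit

variable (K : Type*) [Field K]

/-- The counit of `Λ`: the constant term, i.e. the evaluation at `x_i = 0` for all `i`. -/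
def counitHom : Lam K →ₐ[K] K where
  toRingHom := (MvPowerSeries.constantCoeff (σ := ℕ) (R := K)).comp (symmFun K).val.toRingHom
  commutes' r := by
    change MvPowerSeries.constantCoeff (algebraMap K (MvPowerSeries ℕ K) r) = r
    rw [MvPowerSeries.algebraMap_apply, MvPowerSeries.constantCoeff_C]
    rfl

theorem counitHom_psum (n : ℕ+) : counitHom K (psum K n) = 0 := by
  change coeffL K 0 (psum K n) = 0
  refine if_neg ?_
  rintro ⟨i, h⟩
  exact n.ne_zero (Finsupp.single_eq_zero.1 h.symm)

end Counit

section Hopf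

variable (K : Type*) [Field K] [CharZero K]

instance instBialgebraLam : Bialgebra K (Lam K) :=
  Bialgebra.ofAlgHom (comulHom K) (counitHom K)
    (lam_algHom_ext K fun n => by
      simp [comulHom_psum, Algebra.TensorProduct.one_def, TensorProduct.add_tmul,
        TensorProduct.tmul_add]
      abel)
    (lam_algHom_ext K fun n => by simp [comulHom_psum, counitHom_psum])
    (lam_algHom_ext K fun n => by simp [comulHom_psum, counitHom_psum])

theorem comul_eq (f : Lam K) : Coalgebra.comul (R := K) f = comulHom K f := rfl

theorem counit_eq (f : Lam K) : Coalgebra.counit (R := K) f = counitHom K f := rfl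

instance instHopfAlgebraLam : HopfAlgebra K (Lam K) where
  antipode := (antipodeHom K).toLinearMap
  mul_antipode_rTensor_comul := by
    have h : (Algebra.TensorProduct.lmul' K).comp
        ((Algebra.TensorProduct.map (antipodeHom K) (.id K (Lam K))).comp (comulHom K))
        = (Algebra.ofId K (Lam K)).comp (counitHom K) :=
      lam_algHom_ext K fun n => by simp [comulHom_psum, counitHom_psum, antipodeHom_psum]
    exact congrArg AlgHom.toLinearMap h
  mul_antipode_lTensor_comul := by
    have h : (Algebra.TensorProduct.lmul' K).comp
        ((Algebra.TensorProduct.map (.id K (Lam K)) (antipodeHom K)).comp (comulHom K))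
        = (Algebra.ofId K (Lam K)).comp (counitHom K) :=
      lam_algHom_ext K fun n => by simp [comulHom_psum, counitHom_psum, antipodeHom_psum]
    exact congrArg AlgHom.toLinearMap h

end Hopf

/-! ### The Hopf algebra `Λ̃` -/

/-- The vector space `Λ̃`: the same vector space as `Λ`, which gets a different product below. -/
def LamTilde (K : Type*) [Field K] : Type _ := Lam K

instance instAddCommGroupLamTilde (K : Type*) [Field K] : AddCommGroup (LamTilde K) :=
  inferInstanceAs (AddCommGroup (Lam K))

instance instModuleLamTilde (K : Type*) [Field K] : Module K (LamTilde K) :=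
  inferInstanceAs (Module K (Lam K))

/-- The identity map `Λ → Λ̃`; it is linear but not multiplicative. -/
def toTilde (K : Type*) [Field K] : Lam K ≃ₗ[K] LamTilde K := LinearEquiv.refl K (Lam K)

/-- The degree `n` part of `Λ̃`, the same subspace as the degree `n` part of `Λ`. -/
def homogeneousTilde (K : Type*) [Field K] (n : ℕ) : Submodule K (LamTilde K) :=
  (homogeneous K n).map (toTilde K).toLinearMap

section Poly

variable (K : Type*) [Field K]

open MvPolynomial

/-- The coproduct on polynomials making every variable primitive. -/
def comulPoly : MvPolynomial ℕ+ K →ₐ[K] MvPolynomial ℕ+ K ⊗[K] MvPolynomial ℕ+ K :=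
  aeval fun n => X n ⊗ₜ[K] 1 + 1 ⊗ₜ[K] X n

theorem comulPoly_X (n : ℕ+) : comulPoly K (X n) = X n ⊗ₜ[K] 1 + 1 ⊗ₜ[K] X n := aeval_X _ _

/-- `L ⊗ 1 + 1 ⊗ L`. -/
def coLeibniz (L : MvPolynomial ℕ+ K →ₗ[K] MvPolynomial ℕ+ K) :
    MvPolynomial ℕ+ K ⊗[K] MvPolynomial ℕ+ K →ₗ[K] MvPolynomial ℕ+ K ⊗[K] MvPolynomial ℕ+ K :=
  TensorProduct.map L LinearMap.id + TensorProduct.map LinearMap.id L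

theorem coLeibniz_tmul (L : MvPolynomial ℕ+ K →ₗ[K] MvPolynomial ℕ+ K) (f g : MvPolynomial ℕ+ K) :
    coLeibniz K L (f ⊗ₜ[K] g) = L f ⊗ₜ[K] g + f ⊗ₜ[K] L g := rfl

theorem coLeibniz_shiftD_mul (n : ℕ+) (a b : MvPolynomial ℕ+ K ⊗[K] MvPolynomial ℕ+ K) :
    coLeibniz K (shiftD K n).toLinearMap (a * b)
      = a * coLeibniz K (shiftD K n).toLinearMap b
        + coLeibniz K (shiftD K n).toLinearMap a * b := by
  induction a using TensorProduct.induction_on with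
  | zero => simp
  | add a a' ha ha' => rw [add_mul, map_add, ha, ha', map_add]; ring
  | tmul f g =>
    induction b using TensorProduct.induction_on with
    | zero => simp
    | add b b' hb hb' => rw [mul_add, map_add, hb, hb', map_add]; ring
    | tmul f' g' =>
      have hD : ∀ p q : MvPolynomial ℕ+ K, (shiftD K n).toLinearMap (p * q)
          = p * (shiftD K n).toLinearMap q + (shiftD K n).toLinearMap p * q := by
        intro p q
        change shiftD K n (p * q) = p * shiftD K n q + shiftD K n p * q
        rw [Derivation.leibniz, smul_eq_mul, smul_eq_mul, mul_comm q]
      simp only [Algebra.TensorProduct.tmul_mul_tmul, coLeibniz_tmul, hD, mul_add, add_mul,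
        TensorProduct.add_tmul, TensorProduct.tmul_add]
      abel

theorem comulPoly_shiftD (n : ℕ+) (f : MvPolynomial ℕ+ K) :
    comulPoly K (shiftD K n f) = coLeibniz K (shiftD K n).toLinearMap (comulPoly K f) := by
  have h1 : ∀ g h : MvPolynomial ℕ+ K, (shiftD K n).toLinearMap g = h → shiftD K n g = h :=
    fun _ _ h => h
  induction f using MvPolynomial.induction_on with
  | C a =>
    rw [derivation_C, map_zero, ← algebraMap_eq, AlgHom.commutes,
      Algebra.TensorProduct.algebraMap_apply, coLeibniz_tmul]
    change 0 = shiftD K n _ ⊗ₜ[K] 1 + _ ⊗ₜ[K] shiftD K n 1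
    rw [Derivation.map_one_eq_zero, algebraMap_eq, derivation_C, TensorProduct.zero_tmul,
      TensorProduct.tmul_zero, add_zero]
  | add p q hp hq => rw [map_add, map_add, hp, hq, map_add, map_add]
  | mul_X p k hp =>
    have hX : comulPoly K (shiftD K n (X k))
        = coLeibniz K (shiftD K n).toLinearMap (comulPoly K (X k)) := by
      rw [comulPoly_X, map_add, coLeibniz_tmul, coLeibniz_tmul]
      change comulPoly K (shiftD K n (X k)) = shiftD K n (X k) ⊗ₜ[K] 1 + X k ⊗ₜ[K] shiftD K n 1
        + (shiftD K n 1 ⊗ₜ[K] X k + 1 ⊗ₜ[K] shiftD K n (X k))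
      rw [Derivation.map_one_eq_zero, TensorProduct.zero_tmul, TensorProduct.tmul_zero, add_zero,
        zero_add, shiftD, mkDerivation_X, comulPoly_X]
    rw [Derivation.leibniz, smul_eq_mul, smul_eq_mul, map_add, map_mul, map_mul, map_mul, hp, hX,
      coLeibniz_shiftD_mul, mul_comm (comulPoly K (X k))]

theorem comulPoly_mulP (n : ℕ+) (f : MvPolynomial ℕ+ K) :
    comulPoly K (mulP K n f) = coLeibniz K (mulP K n) (comulPoly K f) := by
  have h : ∀ a : MvPolynomial ℕ+ K ⊗[K] MvPolynomial ℕ+ K, coLeibniz K (mulP K n) a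
      = comulPoly K (X n) * a + coLeibniz K (shiftD K n).toLinearMap a := by
    intro a
    induction a using TensorProduct.induction_on with
    | zero => simp
    | add a b ha hb => rw [map_add, ha, hb, mul_add, map_add]; abel
    | tmul p q =>
      rw [coLeibniz_tmul, coLeibniz_tmul, comulPoly_X, mulP_apply, mulP_apply, add_mul,
        Algebra.TensorProduct.tmul_mul_tmul, Algebra.TensorProduct.tmul_mul_tmul, one_mul, one_mul,
        TensorProduct.add_tmul, TensorProduct.tmul_add]
      change _ = _ + (shiftD K n p ⊗ₜ[K] q + p ⊗ₜ[K] shiftD K n q)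
      abel
  rw [h, mulP_apply, map_add, map_mul, comulPoly_shiftD]

end Poly

section Tilde

variable (K : Type*) [Field K] [CharZero K]

open MvPolynomial

/-- The linear isomorphism from polynomials to `Λ̃` sending `X^r` to `m̃_r`. -/
def augTilde : MvPolynomial ℕ+ K ≃ₗ[K] LamTilde K := (augEquiv K).trans (toTilde K)

theorem augTilde_monomial (r : ℕ+ →₀ ℕ) :
    augTilde K (monomial r 1) = toTilde K (augMonomial K r) := by
  rw [augTilde, LinearEquiv.trans_apply, augEquiv_monomial]

instance instOneLamTilde : One (LamTilde K) := ⟨toTilde K 1⟩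

/-- The product `⊙` of `Λ̃`: the bilinear product with `m̃_r ⊙ m̃_s = m̃_{r + s}`
(see `augMonomial_mul`). -/
instance instMulLamTilde : Mul (LamTilde K) :=
  ⟨fun f g => augTilde K ((augTilde K).symm f * (augTilde K).symm g)⟩

theorem tilde_mul_def (f g : LamTilde K) :
    f * g = augTilde K ((augTilde K).symm f * (augTilde K).symm g) := rfl

theorem augTilde_mul (f g : MvPolynomial ℕ+ K) :
    augTilde K (f * g) = augTilde K f * augTilde K g := by
  rw [tilde_mul_def, LinearEquiv.symm_apply_apply, LinearEquiv.symm_apply_apply]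

theorem augTilde_one : augTilde K 1 = 1 := by
  rw [augTilde, LinearEquiv.trans_apply, augEquiv_apply, augMap_one]
  rfl

theorem augMonomial_mul (r s : ℕ+ →₀ ℕ) :
    toTilde K (augMonomial K r) * toTilde K (augMonomial K s)
      = toTilde K (augMonomial K (r + s)) := by
  rw [← augTilde_monomial, ← augTilde_monomial, ← augTilde_monomial, ← augTilde_mul, monomial_mul,
    one_mul]

instance instCommRingLamTilde : CommRing (LamTilde K) :=
  { instAddCommGroupLamTilde K, instOneLamTilde K, instMulLamTilde K with
    mul_assoc := fun f g h => by
      simp only [tilde_mul_def, LinearEquiv.symm_apply_apply, mul_assoc]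
    mul_comm := fun f g => by rw [tilde_mul_def, mul_comm, ← tilde_mul_def]
    one_mul := fun f => by
      rw [← augTilde_one, tilde_mul_def, LinearEquiv.symm_apply_apply, one_mul,
        LinearEquiv.apply_symm_apply]
    mul_one := fun f => by
      rw [← augTilde_one, tilde_mul_def, LinearEquiv.symm_apply_apply, mul_one,
        LinearEquiv.apply_symm_apply]
    left_distrib := fun f g h => by
      simp only [tilde_mul_def, map_add, mul_add]
    right_distrib := fun f g h => by
      simp only [tilde_mul_def, map_add, add_mul]
    zero_mul := fun f => by
      simp only [tilde_mul_def, map_zero, zero_mul]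
    mul_zero := fun f => by
      simp only [tilde_mul_def, map_zero, mul_zero] }

instance instAlgebraLamTilde : Algebra K (LamTilde K) :=
  Algebra.ofModule
    (fun c f g => by rw [tilde_mul_def, map_smul, smul_mul_assoc, map_smul, ← tilde_mul_def])
    (fun c f g => by rw [tilde_mul_def, map_smul, mul_smul_comm, map_smul, ← tilde_mul_def])

/-- The elements `m̃_1, m̃_2, …` are algebraically independent generators of `Λ̃`. -/
def augTildeAlg : MvPolynomial ℕ+ K ≃ₐ[K] LamTilde K :=
  AlgEquiv.ofLinearEquiv (augTilde K) (augTilde_one K) (augTilde_mul K)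

theorem augTildeAlg_apply (f : MvPolynomial ℕ+ K) : augTildeAlg K f = augTilde K f := rfl

/-- The element `m̃_n` of `Λ̃`. -/
def augGen (n : ℕ+) : LamTilde K := toTilde K (augMonomial K (single n 1))

theorem augTildeAlg_X (n : ℕ+) : augTildeAlg K (X n) = augGen K n :=
  augTilde_monomial K _

theorem augTildeAlg_symm_augGen (n : ℕ+) : (augTildeAlg K).symm (augGen K n) = X n := by
  rw [← augTildeAlg_X, AlgEquiv.symm_apply_apply]

theorem tilde_algHom_ext {B : Type*} [Semiring B] [Algebra K B] {f g : LamTilde K →ₐ[K] B}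
    (h : ∀ n, f (augGen K n) = g (augGen K n)) : f = g := by
  have h1 : f.comp (augTildeAlg K : MvPolynomial ℕ+ K →ₐ[K] LamTilde K)
      = g.comp (augTildeAlg K : MvPolynomial ℕ+ K →ₐ[K] LamTilde K) := by
    refine MvPolynomial.algHom_ext fun n => ?_
    change f (augTildeAlg K (X n)) = g (augTildeAlg K (X n))
    rw [augTildeAlg_X, h]
  ext x
  have := DFunLike.congr_fun h1 ((augTildeAlg K).symm x)
  simpa using this

/-- The coalgebra `Λ̃` has the same coproduct and counit as `Λ`, under the identification of the two
vector spaces. -/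
instance instCoalgebraStructLamTilde : CoalgebraStruct K (LamTilde K) where
  comul := TensorProduct.map (toTilde K).toLinearMap (toTilde K).toLinearMap ∘ₗ
    Coalgebra.comul (R := K) (A := Lam K) ∘ₗ (toTilde K).symm.toLinearMap
  counit := Coalgebra.counit (R := K) (A := Lam K) ∘ₗ (toTilde K).symm.toLinearMap

theorem tilde_comul_toTilde (f : Lam K) :
    Coalgebra.comul (R := K) (toTilde K f)
      = TensorProduct.map (toTilde K).toLinearMap (toTilde K).toLinearMap
        (Coalgebra.comul (R := K) f) := rfl

theorem tilde_counit_toTilde (f : Lam K) :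
    Coalgebra.counit (R := K) (toTilde K f) = Coalgebra.counit (R := K) f := rfl

theorem map_psumToAug_comulPoly (f : MvPolynomial ℕ+ K) :
    TensorProduct.map (psumToAug K) (psumToAug K) (comulPoly K f)
      = comulPoly K (psumToAug K f) := by
  have hmap : ∀ (n : ℕ+) (a : MvPolynomial ℕ+ K ⊗[K] MvPolynomial ℕ+ K),
      TensorProduct.map (psumToAug K) (psumToAug K) (comulPoly K (X n) * a)
        = coLeibniz K (mulP K n) (TensorProduct.map (psumToAug K) (psumToAug K) a) := by
    intro n a
    induction a using TensorProduct.induction_on with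
    | zero => simp
    | add a b ha hb => rw [mul_add, map_add, ha, hb, map_add, map_add]
    | tmul p q =>
      rw [comulPoly_X, add_mul, Algebra.TensorProduct.tmul_mul_tmul,
        Algebra.TensorProduct.tmul_mul_tmul, one_mul, one_mul, map_add, TensorProduct.map_tmul,
        TensorProduct.map_tmul, TensorProduct.map_tmul, coLeibniz_tmul, psumToAug_X_mul,
        psumToAug_X_mul]
  induction f using MvPolynomial.induction_on with
  | C a =>
    have hC : (C a : MvPolynomial ℕ+ K) = a • 1 := by rw [smul_eq_C_mul, mul_one]
    rw [hC, map_smul, map_smul, map_smul, map_smul, psumToAug_one, map_one,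
      Algebra.TensorProduct.one_def, TensorProduct.map_tmul, psumToAug_one]
  | add p q hp hq => simp only [map_add, hp, hq]
  | mul_X p n hp =>
    rw [mul_comm, map_mul, hmap, hp, psumToAug_X_mul, comulPoly_mulP]

theorem comulHom_psumHom (f : MvPolynomial ℕ+ K) :
    comulHom K (psumHom K f)
      = TensorProduct.map (psumHom K).toLinearMap (psumHom K).toLinearMap (comulPoly K f) := by
  have h : (comulHom K).comp (psumHom K)
      = (Algebra.TensorProduct.map (psumHom K) (psumHom K)).comp (comulPoly K) := by
    refine MvPolynomial.algHom_ext fun n => ?_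
    rw [AlgHom.comp_apply, AlgHom.comp_apply, comulPoly_X, ← psumEquiv_apply, psumEquiv_X,
      comulHom_psum, map_add, Algebra.TensorProduct.map_tmul, Algebra.TensorProduct.map_tmul,
      ← psumEquiv_apply, psumEquiv_X, map_one]
  exact DFunLike.congr_fun h f

/-- The coproduct of `Λ̃` as an algebra map for `⊙`. -/
def comulTilde : LamTilde K →ₐ[K] LamTilde K ⊗[K] LamTilde K :=
  ((Algebra.TensorProduct.map (augTildeAlg K : MvPolynomial ℕ+ K →ₐ[K] LamTilde K)
    (augTildeAlg K : MvPolynomial ℕ+ K →ₐ[K] LamTilde K)).comp (comulPoly K)).comp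
    ((augTildeAlg K).symm : LamTilde K →ₐ[K] MvPolynomial ℕ+ K)

theorem comulTilde_augGen (n : ℕ+) :
    comulTilde K (augGen K n) = augGen K n ⊗ₜ[K] 1 + 1 ⊗ₜ[K] augGen K n := by
  change Algebra.TensorProduct.map (augTildeAlg K : MvPolynomial ℕ+ K →ₐ[K] LamTilde K)
    (augTildeAlg K : MvPolynomial ℕ+ K →ₐ[K] LamTilde K)
      (comulPoly K ((augTildeAlg K).symm (augGen K n))) = _
  rw [augTildeAlg_symm_augGen, comulPoly_X, map_add, Algebra.TensorProduct.map_tmul,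
    Algebra.TensorProduct.map_tmul, map_one]
  change augTildeAlg K (X n) ⊗ₜ[K] 1 + 1 ⊗ₜ[K] augTildeAlg K (X n) = _
  rw [augTildeAlg_X]

theorem comul_eq_comulTilde (x : LamTilde K) : Coalgebra.comul (R := K) x = comulTilde K x := by
  obtain ⟨f, rfl⟩ := (augTilde K).surjective x
  obtain ⟨g, rfl⟩ := psumToAug_surjective K f
  have h1 : ∀ g, augTilde K (psumToAug K g) = toTilde K (psumHom K g) := fun g => by
    rw [augTilde, LinearEquiv.trans_apply, augEquiv_psumToAug]
  have h2 : comulTilde K (augTilde K (psumToAug K g))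
      = TensorProduct.map (augTilde K).toLinearMap (augTilde K).toLinearMap
        (comulPoly K (psumToAug K g)) := by
    change TensorProduct.map (augTilde K).toLinearMap (augTilde K).toLinearMap
      (comulPoly K ((augTilde K).symm (augTilde K (psumToAug K g)))) = _
    rw [LinearEquiv.symm_apply_apply]
  have h3 : (toTilde K).toLinearMap ∘ₗ (psumHom K).toLinearMap
      = (augTilde K).toLinearMap ∘ₗ psumToAug K := by
    exact LinearMap.ext fun f => (h1 f).symm
  rw [h2, ← map_psumToAug_comulPoly, h1, tilde_comul_toTilde, comul_eq, comulHom_psumHom,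
    ← LinearMap.comp_apply, ← LinearMap.comp_apply, ← TensorProduct.map_comp,
    ← TensorProduct.map_comp, h3]

/-- The antipode of `Λ̃`: the algebra map with `m̃_n ↦ -m̃_n`. -/
def antipodeTilde : LamTilde K →ₐ[K] LamTilde K :=
  (aeval fun n => -augGen K n).comp ((augTildeAlg K).symm : LamTilde K →ₐ[K] MvPolynomial ℕ+ K)

theorem antipodeTilde_augGen (n : ℕ+) : antipodeTilde K (augGen K n) = -augGen K n := by
  change aeval _ ((augTildeAlg K).symm (augGen K n)) = _
  rw [augTildeAlg_symm_augGen, aeval_X]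

/-- The counit of `Λ̃` as an algebra map for `⊙`. -/
def counitTilde : LamTilde K →ₐ[K] K :=
  (aeval fun _ => (0 : K)).comp ((augTildeAlg K).symm : LamTilde K →ₐ[K] MvPolynomial ℕ+ K)

theorem counitTilde_augGen (n : ℕ+) : counitTilde K (augGen K n) = 0 := by
  change aeval _ ((augTildeAlg K).symm (augGen K n)) = _
  rw [augTildeAlg_symm_augGen, aeval_X]

theorem counit_eq_counitTilde (x : LamTilde K) :
    Coalgebra.counit (R := K) x = counitTilde K x := by
  obtain ⟨f, rfl⟩ := (augTilde K).surjective x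
  have h2 : counitTilde K (augTilde K f) = aeval (fun _ => (0 : K)) f := by
    change aeval _ ((augTilde K).symm (augTilde K f)) = _
    rw [LinearEquiv.symm_apply_apply]
  have h3 : coeffL K 0 (augMap K f) = constantCoeff f := by
    rw [coeffL_augMap, shape_zero, constantCoeff_eq]
    simp [multFactorial]
  rw [h2, augTilde, LinearEquiv.trans_apply, tilde_counit_toTilde, counit_eq, augEquiv_apply]
  change coeffL K 0 (augMap K f) = _
  rw [h3, aeval_def, eval₂_zero'_apply]
  rfl

instance instCoalgebraLamTilde : Coalgebra K (LamTilde K) :=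
  have hΔ : Coalgebra.comul (R := K) (A := LamTilde K) = (comulTilde K).toLinearMap :=
    LinearMap.ext (comul_eq_comulTilde K)
  have hε : Coalgebra.counit (R := K) (A := LamTilde K) = (counitTilde K).toLinearMap :=
    LinearMap.ext (counit_eq_counitTilde K)
  { instCoalgebraStructLamTilde K with
    coassoc := by
      have h : (Algebra.TensorProduct.assoc K K K _ _ _).toAlgHom.comp
          ((Algebra.TensorProduct.map (comulTilde K) (.id K (LamTilde K))).comp (comulTilde K))
          = (Algebra.TensorProduct.map (.id K (LamTilde K)) (comulTilde K)).comp (comulTilde K) :=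
        tilde_algHom_ext K fun n => by
          simp [comulTilde_augGen, Algebra.TensorProduct.one_def, TensorProduct.add_tmul,
            TensorProduct.tmul_add]
          abel
      rw [hΔ]
      exact congrArg AlgHom.toLinearMap h
    rTensor_counit_comp_comul := by
      have h : (Algebra.TensorProduct.map (counitTilde K) (.id K (LamTilde K))).comp (comulTilde K)
          = (Algebra.TensorProduct.lid K (LamTilde K)).symm :=
        tilde_algHom_ext K fun n => by simp [comulTilde_augGen, counitTilde_augGen]
      rw [hΔ, hε]
      exact congrArg AlgHom.toLinearMap h
    lTensor_counit_comp_comul := by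
      have h : (Algebra.TensorProduct.map (.id K (LamTilde K)) (counitTilde K)).comp (comulTilde K)
          = (Algebra.TensorProduct.rid K K (LamTilde K)).symm :=
        tilde_algHom_ext K fun n => by simp [comulTilde_augGen, counitTilde_augGen]
      rw [hΔ, hε]
      exact congrArg AlgHom.toLinearMap h }

instance instBialgebraLamTilde : Bialgebra K (LamTilde K) :=
  Bialgebra.mk' K (LamTilde K)
    ((counit_eq_counitTilde K 1).trans (map_one _))
    (fun {a b} => by
      rw [counit_eq_counitTilde, counit_eq_counitTilde, counit_eq_counitTilde, map_mul])
    ((comul_eq_comulTilde K 1).trans (map_one _))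
    (fun {a b} => by
      rw [comul_eq_comulTilde, comul_eq_comulTilde, comul_eq_comulTilde, map_mul])

instance instHopfAlgebraLamTilde : HopfAlgebra K (LamTilde K) where
  antipode := (antipodeTilde K).toLinearMap
  mul_antipode_rTensor_comul := by
    have hΔ : Coalgebra.comul (R := K) (A := LamTilde K) = (comulTilde K).toLinearMap :=
      LinearMap.ext (comul_eq_comulTilde K)
    have hε : Coalgebra.counit (R := K) (A := LamTilde K) = (counitTilde K).toLinearMap :=
      LinearMap.ext (counit_eq_counitTilde K)
    have h : (Algebra.TensorProduct.lmul' K).comp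
        ((Algebra.TensorProduct.map (antipodeTilde K) (.id K (LamTilde K))).comp (comulTilde K))
        = (Algebra.ofId K (LamTilde K)).comp (counitTilde K) :=
      tilde_algHom_ext K fun n => by
        simp [comulTilde_augGen, counitTilde_augGen, antipodeTilde_augGen]
    rw [hΔ, hε]
    exact congrArg AlgHom.toLinearMap h
  mul_antipode_lTensor_comul := by
    have hΔ : Coalgebra.comul (R := K) (A := LamTilde K) = (comulTilde K).toLinearMap :=
      LinearMap.ext (comul_eq_comulTilde K)
    have hε : Coalgebra.counit (R := K) (A := LamTilde K) = (counitTilde K).toLinearMap :=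
      LinearMap.ext (counit_eq_counitTilde K)
    have h : (Algebra.TensorProduct.lmul' K).comp
        ((Algebra.TensorProduct.map (.id K (LamTilde K)) (antipodeTilde K)).comp (comulTilde K))
        = (Algebra.ofId K (LamTilde K)).comp (counitTilde K) :=
      tilde_algHom_ext K fun n => by
        simp [comulTilde_augGen, counitTilde_augGen, antipodeTilde_augGen]
    rw [hΔ, hε]
    exact congrArg AlgHom.toLinearMap h

end Tilde

/-! ### Chromatic symmetric functions -/

/-- A weighted graph on the vertex set `V`: a simple graph with positive integer vertex weights. -/
structure WeightedGraph (V : Type*) where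
  /-- The underlying graph. -/
  graph : SimpleGraph V
  /-- The vertex weights. -/
  weight : V → ℕ+

namespace WeightedGraph

variable {V : Type*}

/-- The complement, with the same vertex weights. -/
def compl (G : WeightedGraph V) : WeightedGraph V := ⟨G.graphᶜ, G.weight⟩

/-- Every two distinct vertices are adjacent. -/
def IsClique (G : WeightedGraph V) : Prop := ∀ u v : V, u ≠ v → G.graph.Adj u v

/-- The weight of a set of vertices. -/
def setWeight (G : WeightedGraph V) (S : Finset V) : ℕ := ∑ x ∈ S, (G.weight x : ℕ)

variable [Fintype V]

/-- The exponent of the monomial `∏ v, x_{κ(v)}^{w(v)}` of a coloring `κ`. -/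
def exponent (G : WeightedGraph V) (κ : V → ℕ) : ℕ →₀ ℕ :=
  ∑ x, single (κ x) (G.weight x : ℕ)

theorem exponent_perm (G : WeightedGraph V) (σ : Equiv.Perm ℕ) (κ : V → ℕ) :
    G.exponent (σ ∘ κ) = (G.exponent κ).equivMapDomain σ := by
  simp only [exponent, equivMapDomain_eq_mapDomain, Function.comp_apply]
  rw [Finsupp.mapDomain_finsetSum]
  simp only [Finsupp.mapDomain_single]

theorem degree_exponent (G : WeightedGraph V) (κ : V → ℕ) :
    (G.exponent κ).degree = G.setWeight Finset.univ := by
  simp [exponent, setWeight]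

/-- The set of proper colorings `κ` of `G` whose monomial `∏ v, x_{κ(v)}^{w(v)}` is `x^d`. -/
def coloringsOf (G : WeightedGraph V) (d : ℕ →₀ ℕ) : Set (V → ℕ) :=
  {κ | (∀ u v, G.graph.Adj u v → κ u ≠ κ v) ∧ G.exponent κ = d}

/-- There are finitely many colorings with a given monomial, so that their number `Set.ncard` is
the actual cardinality. -/
theorem finite_coloringsOf (G : WeightedGraph V) (d : ℕ →₀ ℕ) : (G.coloringsOf d).Finite := by
  refine Set.Finite.subset (Set.Finite.pi' fun _ : V => d.support.finite_toSet) ?_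
  rintro κ ⟨_, rfl⟩ x
  rw [Finset.mem_coe, Finsupp.mem_support_iff, exponent, Finsupp.finsetSum_apply]
  refine (lt_of_lt_of_le (G.weight x).pos ?_).ne'
  have := Finset.single_le_sum (f := fun y => single (κ y) (G.weight y : ℕ) (κ x))
    (fun _ _ => Nat.zero_le _) (Finset.mem_univ x)
  simpa using this

/-- The chromatic symmetric function `X_G = ∑_κ ∏_v x_{κ(v)}^{w(v)}`, the sum being over all proper
colorings `κ` of `G`: the coefficient of `x^d` is the number of `κ` whose monomial is `x^d`. -/
def csf (K : Type*) [Field K] (G : WeightedGraph V) : Lam K :=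
  ⟨fun d => ((G.coloringsOf d).ncard : K), by
    refine ⟨⟨G.setWeight Finset.univ, fun d hd => ?_⟩, fun σ d => ?_⟩
    · have h : (G.coloringsOf d).Nonempty := by
        by_contra h
        rw [Set.not_nonempty_iff_eq_empty] at h
        apply hd
        change ((G.coloringsOf d).ncard : K) = 0
        rw [h, Set.ncard_empty, Nat.cast_zero]
      obtain ⟨κ, _, rfl⟩ := h
      rw [degree_exponent]
    · change ((G.coloringsOf _).ncard : K) = ((G.coloringsOf _).ncard : K)
      congr 1
      symm
      refine Set.ncard_congr (fun κ _ => σ ∘ κ) ?_ ?_ ?_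
      · rintro κ ⟨h1, rfl⟩
        exact ⟨fun u v huv h => h1 u v huv (σ.injective h), exponent_perm G σ κ⟩
      · intro κ κ' _ _ h
        exact σ.injective.comp_left h
      · rintro κ ⟨h1, h2⟩
        refine ⟨σ.symm ∘ κ, ⟨fun u v huv h => h1 u v huv (σ.symm.injective h), ?_⟩, ?_⟩
        · rw [exponent_perm, h2]
          ext; simp
        · ext; simp⟩

end WeightedGraph

end SymmFun

end

/-! Both algebras are polynomial algebras on primitive generators, the `p_n` for `Λ` and the `m̃_n`
for `Λ̃`, with the `n`-th generator in degree `n`. So for any nonzero scalars `c_n` the rule `p_n ↦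
c_n m̃_n` extends uniquely to an isomorphism of graded Hopf algebras. The choice of `c_n` matters
only for the statement about cliques.

For a clique with vertex weights `w`, proper colorings are the injective ones, so `X_G` is the
augmented monomial function of the weights (`csf_of_isClique`). The complement has no edges, so its
function is `∏ p_{w(x)}` (`csf_compl_of_isClique`). It remains to send the former to the latter.

Write `m̃_S` and `p_S` for the two functions attached to a vertex set `S`. Two expansions over the
subsets `T` of `S` do the work: `m̃_{S ∪ x} = ∑ (-1)^|T| |T|! p_{w(x)+w(T)} m̃_{S∖T}` in `Λ`
(`X_mul_prod_X`), and `p_{S ∪ x} = ∑ m̃_{w(x)+w(T)} ⊙ p_{S∖T}` in `Λ̃` (`mulP_psumToAug_prod_X`).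
Applying the isomorphism to the first and using induction for `S∖T`, the sums agree term by term as
soon as `c_n (-1)^|T| |T|! = 1` for `n = w(x) + w(T)`. Since `T ∪ {x}` has weight `n`, it has `v_n =
|T| + 1` elements, and this is exactly the given value of `c_n` (`scaleAlgEquiv_augMap_prod_X`).

Computations take place in the polynomial ring whose monomials stand for the `m̃_r`: its product is
`⊙`, and `mulP K n` is the ordinary multiplication by `p_n`. -/

noncomputable section

namespace SymmFun

open Finsupp MvPolynomial
open scoped TensorProduct

/-! ### Expansions of augmented monomials and of products of power sums. -/

section Expansion

variable (K : Type*) [Field K]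

/-- The positive integer `n + ∑ x ∈ T, w x`. -/
def addWeight {V : Type*} (n : ℕ+) (w : V → ℕ+) (T : Finset V) : ℕ+ :=
  ⟨(n : ℕ) + ∑ x ∈ T, (w x : ℕ), Nat.add_pos_left n.pos _⟩

theorem addWeight_coe {V : Type*} (n : ℕ+) (w : V → ℕ+) (T : Finset V) :
    (addWeight n w T : ℕ) = (n : ℕ) + ∑ x ∈ T, (w x : ℕ) := rfl

theorem addWeight_empty {V : Type*} (n : ℕ+) (w : V → ℕ+) : addWeight n w ∅ = n :=
  PNat.eq (by simp [addWeight_coe])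

theorem addWeight_insert {V : Type*} [DecidableEq V] (n : ℕ+) (w : V → ℕ+) {T : Finset V} {y : V}
    (hy : y ∉ T) : addWeight n w (insert y T) = addWeight n w T + w y :=
  PNat.eq (by rw [PNat.add_coe, addWeight_coe, addWeight_coe, Finset.sum_insert hy]; ring)

theorem addWeight_add {V : Type*} [DecidableEq V] (n : ℕ+) (w : V → ℕ+) {T : Finset V} {y : V}
    (hy : y ∉ T) : addWeight (w y + n) w T = addWeight n w (insert y T) :=
  PNat.eq (by rw [addWeight_coe, addWeight_coe, PNat.add_coe, Finset.sum_insert hy]; ring)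

/-- A pair of `y` and a set `T` avoiding `y` is the same as the set `U = T ∪ {y}` with a marked
element. When `f y U` does not depend on `y`, each `U` is therefore counted `U.card` times. -/
theorem sum_sum_powerset_erase {V M : Type*} [DecidableEq V] [AddCommMonoid M] (S : Finset V)
    (f : V → Finset V → M) :
    ∑ y ∈ S, ∑ T ∈ (S.erase y).powerset, f y (insert y T)
      = ∑ U ∈ S.powerset, ∑ y ∈ U, f y U := by
  rw [Finset.sum_sigma', Finset.sum_sigma']
  refine Finset.sum_bij' (fun p _ => ⟨insert p.1 p.2, p.1⟩) (fun q _ => ⟨q.2, q.1.erase q.2⟩)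
    ?_ ?_ ?_ ?_ ?_
  · rintro ⟨y, T⟩ h
    simp only [Finset.mem_sigma, Finset.mem_powerset] at h ⊢
    exact ⟨Finset.insert_subset h.1 (h.2.trans (Finset.erase_subset _ _)),
      Finset.mem_insert_self _ _⟩
  · rintro ⟨U, y⟩ h
    simp only [Finset.mem_sigma, Finset.mem_powerset] at h ⊢
    exact ⟨h.1 h.2, Finset.erase_subset_erase _ h.1⟩
  · rintro ⟨y, T⟩ h
    simp only [Finset.mem_sigma, Finset.mem_powerset] at h
    have : y ∉ T := fun hy => by simpa using h.2 hy
    simp [Finset.erase_insert this]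
  · rintro ⟨U, y⟩ h
    simp only [Finset.mem_sigma, Finset.mem_powerset] at h
    simp [Finset.insert_erase h.2]
  · rintro ⟨y, T⟩ _
    rfl

/-- These are the terms of `p_n m̃_S` in which the exponent `n` merges with an existing part instead
of becoming a part of its own. -/
theorem shiftD_prod_X {V : Type*} [DecidableEq V] (w : V → ℕ+) (n : ℕ+) (S : Finset V) :
    shiftD K n (∏ x ∈ S, X (w x)) = ∑ y ∈ S, X (w y + n) * ∏ x ∈ S.erase y, X (w x) := by
  induction S using Finset.induction with
  | empty => simp
  | insert y S hy ih =>
    rw [Finset.prod_insert hy, Derivation.leibniz, ih, shiftD, mkDerivation_X, smul_eq_mul,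
      smul_eq_mul, Finset.sum_insert hy, Finset.erase_insert hy, Finset.mul_sum, add_comm,
      mul_comm _ (X (w y + n))]
    congr 1
    refine Finset.sum_congr rfl fun z hz => ?_
    have hzy : y ≠ z := fun h => hy (h ▸ hz)
    rw [Finset.erase_insert_of_ne hzy, Finset.prod_insert fun h => hy (Finset.mem_of_mem_erase h),
      mul_left_comm]

/-- Multiplication by `X_n` in terms of the operators `mulP`. -/
theorem X_mul_prod_X {V : Type*} [DecidableEq V] (w : V → ℕ+) (S : Finset V) : ∀ n : ℕ+,
    X n * ∏ x ∈ S, X (w x) = ∑ T ∈ S.powerset, ((-1) ^ T.card * (T.card.factorial : K)) •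
      mulP K (addWeight n w T) (∏ x ∈ S \ T, X (w x)) := by
  induction S using Finset.strongInduction with
  | H S ih =>
    intro n
    -- Solve `p_n m̃_S = m̃_{n, S} + (merged terms)` for the unmerged term. Each merged term has the
    -- original shape with a smaller set and `w y + n` in place of `n`, which is why the induction
    -- keeps `n` general.
    have h1 : X n * ∏ x ∈ S, X (w x) = mulP K n (∏ x ∈ S, X (w x))
        - ∑ y ∈ S, X (w y + n) * ∏ x ∈ S.erase y, X (w x) := by
      rw [mulP_apply, shiftD_prod_X, add_sub_cancel_right]
    -- The coefficient is written through `U = insert y T`, with `T.card = U.card - 1`, so that the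
    -- summand depends on `U` alone and can be regrouped.
    have h2 : ∀ y ∈ S, (X (w y + n) * ∏ x ∈ S.erase y, X (w x) : MvPolynomial ℕ+ K)
        = ∑ T ∈ (S.erase y).powerset,
          ((-1) ^ ((insert y T).card - 1) * (((insert y T).card - 1).factorial : K)) •
            mulP K (addWeight n w (insert y T)) (∏ x ∈ S \ insert y T, X (w x)) := by
      intro y hy
      rw [ih _ (Finset.erase_ssubset hy)]
      refine Finset.sum_congr rfl fun T hT => ?_
      have hyT : y ∉ T := fun h => by simpa using Finset.mem_powerset.1 hT h
      rw [Finset.card_insert_of_notMem hyT, Nat.add_sub_cancel, addWeight_add n w hyT]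
      have hST : S.erase y \ T = S \ insert y T := by
        rw [Finset.erase_sdiff_comm, Finset.sdiff_insert]
      rw [hST]
    rw [h1, Finset.sum_congr rfl h2, sum_sum_powerset_erase S fun _ U =>
      ((-1) ^ (U.card - 1) * ((U.card - 1).factorial : K)) •
        mulP K (addWeight n w U) (∏ x ∈ S \ U, X (w x)), sub_eq_iff_eq_add,
      ← Finset.sum_add_distrib,
      Finset.sum_eq_single_of_mem ∅ (Finset.empty_mem_powerset S)]
    · simp [addWeight_empty]
    -- With `U.card = m + 1` the coefficients cancel: `(-1)^(m+1) (m+1)! + (m+1) (-1)^m m! = 0`.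
    -- Only `U = ∅` survives.
    · intro U _ hU
      obtain ⟨m, hm⟩ := Nat.exists_eq_succ_of_ne_zero (Finset.card_ne_zero.2
        (Finset.nonempty_iff_ne_empty.2 hU))
      rw [Finset.sum_const, hm, ← Nat.cast_smul_eq_nsmul K, smul_smul, ← add_smul]
      convert zero_smul K _
      simp only [Nat.succ_eq_add_one, Nat.add_sub_cancel, Nat.factorial_succ]
      push_cast
      ring

/-- By the Leibniz rule, `p_m` either acts on the remaining factor or is absorbed by the part `k`.
-/
theorem mulP_X_mul (m k : ℕ+) (f : MvPolynomial ℕ+ K) :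
    mulP K m (X k * f) = X k * mulP K m f + X (k + m) * f := by
  rw [mulP_apply, mulP_apply, Derivation.leibniz, shiftD, mkDerivation_X, smul_eq_mul, smul_eq_mul]
  ring

variable [CharZero K]

/-- The operators are multiplications by `p_n` and `p_m` seen through the bijection `psumToAug`, so
commutativity of `Λ` suffices. -/
theorem mulP_comm (n m : ℕ+) (f : MvPolynomial ℕ+ K) :
    mulP K n (mulP K m f) = mulP K m (mulP K n f) := by
  obtain ⟨g, rfl⟩ := psumToAug_surjective K f
  simp only [← psumToAug_X_mul]
  rw [mul_left_comm]

theorem psumToAug_prod_insert {V : Type*} [DecidableEq V] (w : V → ℕ+) {S : Finset V} {y : V}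
    (hy : y ∉ S) : psumToAug K (∏ x ∈ insert y S, X (w x))
      = mulP K (w y) (psumToAug K (∏ x ∈ S, X (w x))) := by
  rw [Finset.prod_insert hy, psumToAug_X_mul]

/-- In terms of colorings, `T` is the set of vertices that share the color of a new vertex of weight
`n`. In the induction, multiplying a term by `p_{w y}` either leaves `y` outside `T` or absorbs it
into the part `n + w(T)`. These are the two halves of the power set of `insert y S`. -/
theorem mulP_psumToAug_prod_X {V : Type*} [DecidableEq V] (w : V → ℕ+) (n : ℕ+) (S : Finset V) :
    mulP K n (psumToAug K (∏ x ∈ S, X (w x)))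
      = ∑ T ∈ S.powerset, X (addWeight n w T) * psumToAug K (∏ x ∈ S \ T, X (w x)) := by
  induction S using Finset.induction with
  | empty => simp [addWeight_empty, psumToAug_one, mulP_apply]
  | insert y S hy ih =>
    rw [psumToAug_prod_insert K w hy, mulP_comm, ih, map_sum, Finset.sum_powerset_insert hy,
      ← Finset.sum_add_distrib]
    refine Finset.sum_congr rfl fun T hT => ?_
    have hyT : y ∉ T := fun h => hy (Finset.mem_powerset.1 hT h)
    rw [mulP_X_mul, addWeight_insert n w hyT, Finset.insert_sdiff_of_notMem _ hyT,
      psumToAug_prod_insert K w (fun h => hy (Finset.mem_sdiff.1 h).1),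
      Finset.insert_sdiff_insert]
    -- What is left is `S \ T = S \ insert y T`, true because `y ∉ S`.
    congr 4
    ext x
    simp only [Finset.mem_sdiff, Finset.mem_insert]
    constructor
    · exact fun h => ⟨h.1, fun h' => h'.elim (fun e => hy (e ▸ h.1)) h.2⟩
    · exact fun h => ⟨h.1, fun h' => h.2 (Or.inr h')⟩

end Expansion

/-! ### Compatibility with the gradings. -/

section Grading

variable (K : Type*) [Field K]

/-- The polynomials that are homogeneous of degree `n` when the variable `X_k` has degree `k`. -/
def polyHomogeneous (n : ℕ) : Submodule K (MvPolynomial ℕ+ K) :=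
  weightedHomogeneousSubmodule K (fun k : ℕ+ => (k : ℕ)) n

theorem monomial_mem_polyHomogeneous (s : ℕ+ →₀ ℕ) (c : K) :
    monomial s c ∈ polyHomogeneous K (s.weight fun k : ℕ+ => (k : ℕ)) :=
  isWeightedHomogeneous_monomial _ _ _ rfl

theorem polyHomogeneous_le {n : ℕ} {W : Submodule K (MvPolynomial ℕ+ K)}
    (h : ∀ s : ℕ+ →₀ ℕ, s.weight (fun k : ℕ+ => (k : ℕ)) = n → monomial s 1 ∈ W) :
    polyHomogeneous K n ≤ W := by
  intro f hf
  rw [f.as_sum]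
  refine Submodule.sum_mem _ fun s hs => ?_
  rw [← mul_one (coeff s f), ← smul_eq_mul, ← smul_monomial]
  exact W.smul_mem _ (h s (hf (MvPolynomial.mem_support_iff.1 hs)))

/-- The coefficient of `x^d` is a nonzero multiple of the coefficient at `shape d`, whose weight is
the degree of `d`. Every partition is a shape, so neither side imposes more conditions than the
other. -/
theorem augMap_mem_homogeneous [CharZero K] {n : ℕ} {f : MvPolynomial ℕ+ K} :
    augMap K f ∈ homogeneous K n ↔ f ∈ polyHomogeneous K n := by
  have hw : ∀ d : ℕ →₀ ℕ, d.degree = (shape d).weight fun k : ℕ+ => (k : ℕ) := fun d => by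
    rw [degree_eq_of_shape, weight_apply]
    rfl
  have hc : ∀ d : ℕ →₀ ℕ, coeffL K d (augMap K f) ≠ 0 ↔ coeff (shape d) f ≠ 0 := fun d => by
    rw [coeffL_augMap, mul_ne_zero_iff, and_iff_right]
    exact Nat.cast_ne_zero.2 (multFactorial_ne_zero _)
  constructor
  · intro h s hs
    obtain ⟨d, rfl⟩ := exists_shape_eq s
    rw [← hw]
    exact h d ((hc d).2 hs)
  · intro h d hd
    rw [hw]
    exact h ((hc d).1 hd)

theorem mulP_mem_polyHomogeneous (k : ℕ+) {n : ℕ} {f : MvPolynomial ℕ+ K}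
    (hf : f ∈ polyHomogeneous K n) : mulP K k f ∈ polyHomogeneous K (n + k) := by
  refine polyHomogeneous_le K (W := (polyHomogeneous K (n + k)).comap (mulP K k)) ?_ hf
  rintro s rfl
  rw [Submodule.mem_comap, mulP_apply]
  refine Submodule.add_mem _ ?_ ?_
  · rw [add_comm]
    exact (isWeightedHomogeneous_X K _ k).mul (monomial_mem_polyHomogeneous K s 1)
  · rw [shiftD, mkDerivation_monomial, one_smul]
    refine Submodule.sum_mem _ fun j hj => ?_
    -- The shift replaces one part `j` by `j + k`, raising the weight by `k`.
    change monomial (s - single j 1) (s j : K) * X (j + k) ∈ _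
    have h : single j 1 ≤ s := by
      rw [Finsupp.single_le_iff]
      exact Nat.one_le_iff_ne_zero.2 (by simpa using hj)
    have h2 := (monomial_mem_polyHomogeneous K (s - single j 1) (s j : K)).mul
      (isWeightedHomogeneous_X K (fun k : ℕ+ => (k : ℕ)) (j + k))
    have h3 : s.weight (fun k : ℕ+ => (k : ℕ)) + k
        = (s - single j 1).weight (fun k : ℕ+ => (k : ℕ)) + ((j + k : ℕ+) : ℕ) := by
      conv_lhs => rw [← tsub_add_cancel_of_le h]
      rw [map_add, weight_single, PNat.add_coe, one_smul, add_assoc]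
    rw [h3]
    exact h2

theorem psumToAug_mem_polyHomogeneous [CharZero K] {n : ℕ} {f : MvPolynomial ℕ+ K}
    (hf : f ∈ polyHomogeneous K n) : psumToAug K f ∈ polyHomogeneous K n := by
  refine polyHomogeneous_le K (W := (polyHomogeneous K n).comap (psumToAug K)) ?_ hf
  rintro s rfl
  refine part_induction (P := fun s => psumToAug K (monomial s 1)
    ∈ polyHomogeneous K (s.weight fun k : ℕ+ => (k : ℕ))) ?_ ?_ s
  · rw [show (monomial (0 : ℕ+ →₀ ℕ) (1 : K)) = 1 from rfl, psumToAug_one]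
    exact monomial_mem_polyHomogeneous K 0 1
  · intro s k h
    have hs : monomial (s + single k 1) (1 : K) = X k * monomial s 1 := by
      rw [X, monomial_mul, add_comm, one_mul]
    rw [hs, psumToAug_X_mul, map_add, weight_single, one_smul]
    exact mulP_mem_polyHomogeneous K k h

/-- An injective linear map that preserves degrees also reflects them. -/
theorem mem_polyHomogeneous_of_map (L : MvPolynomial ℕ+ K →ₗ[K] MvPolynomial ℕ+ K)
    (hL : Function.Injective L)
    (h : ∀ (n : ℕ) (f : MvPolynomial ℕ+ K), f ∈ polyHomogeneous K n → L f ∈ polyHomogeneous K n)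
    {n : ℕ} {f : MvPolynomial ℕ+ K} (hf : L f ∈ polyHomogeneous K n) :
    f ∈ polyHomogeneous K n := by
  -- A degree-preserving map commutes with the projection to degree `n`. Hence `L f` equals `L` of
  -- the degree `n` component of `f`, and injectivity identifies `f` with that component.
  have hcomm : ∀ g, weightedHomogeneousComponent (fun k : ℕ+ => (k : ℕ)) n (L g)
      = L (weightedHomogeneousComponent (fun k : ℕ+ => (k : ℕ)) n g) := by
    intro g
    induction g using MvPolynomial.induction_on' with
    | monomial s c =>
      have h1 := monomial_mem_polyHomogeneous K s c
      rw [weightedHomogeneousComponent_of_mem (h _ _ h1), weightedHomogeneousComponent_of_mem h1]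
      split_ifs <;> simp
    | add p q hp hq => simp only [map_add, hp, hq]
  have h1 := hcomm f
  rw [IsWeightedHomogeneous.weightedHomogeneousComponent_same hf] at h1
  rw [hL h1]
  exact weightedHomogeneousComponent_mem _ _ _

end Grading

/-! ### The isomorphisms `p_n ↦ c_n m̃_n`. -/

section Scaling

variable {K : Type*} [Field K] (c : ℕ+ → K)

/-- The algebra map `X_n ↦ c_n X_n`. -/
def scaleHom : MvPolynomial ℕ+ K →ₐ[K] MvPolynomial ℕ+ K := aeval fun n => C (c n) * X n

theorem scaleHom_X (n : ℕ+) : scaleHom c (X n) = C (c n) * X n := aeval_X _ _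

theorem scaleHom_comp {c d : ℕ+ → K} (h : ∀ n, c n * d n = 1) :
    (scaleHom c).comp (scaleHom d) = AlgHom.id K _ := by
  refine MvPolynomial.algHom_ext fun n => ?_
  rw [AlgHom.comp_apply, scaleHom_X, map_mul, scaleHom_X, ← algebraMap_eq, AlgHom.commutes,
    algebraMap_eq, ← mul_assoc, ← C_mul, mul_comm (d n), h, C_1, one_mul, AlgHom.id_apply]

/-- The algebra automorphism `X_n ↦ c_n X_n` for nonzero `c_n`. -/
def scaleEquiv (hc : ∀ n, c n ≠ 0) : MvPolynomial ℕ+ K ≃ₐ[K] MvPolynomial ℕ+ K :=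
  AlgEquiv.ofAlgHom (scaleHom c) (scaleHom fun n => (c n)⁻¹)
    (scaleHom_comp fun n => mul_inv_cancel₀ (hc n))
    (scaleHom_comp fun n => inv_mul_cancel₀ (hc n))

theorem scaleHom_mem_polyHomogeneous {n : ℕ} {f : MvPolynomial ℕ+ K}
    (hf : f ∈ polyHomogeneous K n) : scaleHom c f ∈ polyHomogeneous K n := by
  refine polyHomogeneous_le K (W := (polyHomogeneous K n).comap (scaleHom c).toLinearMap) ?_ hf
  rintro s rfl
  refine part_induction (P := fun s => scaleHom c (monomial s 1)
    ∈ polyHomogeneous K (s.weight fun k : ℕ+ => (k : ℕ))) ?_ ?_ s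
  · rw [show (monomial (0 : ℕ+ →₀ ℕ) (1 : K)) = 1 from rfl, map_one]
    exact monomial_mem_polyHomogeneous K 0 1
  · intro s k h
    have hs : monomial (s + single k 1) (1 : K) = monomial s 1 * X k := by
      rw [X, monomial_mul, one_mul]
    rw [hs, map_mul, scaleHom_X, map_add, weight_single, one_smul]
    exact IsWeightedHomogeneous.mul h ((isWeightedHomogeneous_X K _ k).C_mul _)

variable [CharZero K] (hc : ∀ n, c n ≠ 0)

/-- The algebra isomorphism `Λ → Λ̃` with `p_n ↦ c_n m̃_n`. -/
def scaleAlgEquiv : Lam K ≃ₐ[K] LamTilde K :=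
  ((psumEquiv K).symm.trans (scaleEquiv c hc)).trans (augTildeAlg K)

theorem scaleAlgEquiv_psumHom (f : MvPolynomial ℕ+ K) :
    scaleAlgEquiv c hc (psumHom K f) = augTilde K (scaleHom c f) := by
  change augTilde K (scaleHom c ((psumEquiv K).symm (psumEquiv K f))) = _
  rw [AlgEquiv.symm_apply_apply]

theorem scaleAlgEquiv_psum (n : ℕ+) : scaleAlgEquiv c hc (psum K n) = c n • augGen K n := by
  have h : psumHom K (X n) = psum K n := aeval_X _ _
  rw [← h, scaleAlgEquiv_psumHom, scaleHom_X, ← smul_eq_C_mul, map_smul, ← augTildeAlg_apply,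
    augTildeAlg_X]

/-- The Hopf algebra isomorphism `Λ → Λ̃` with `p_n ↦ c_n m̃_n`. -/
def scaleBialgEquiv : Lam K ≃ₐc[K] LamTilde K :=
  BialgEquiv.ofAlgEquiv (scaleAlgEquiv c hc)
    -- Counit and coproduct are algebra maps on both sides, so it is enough to compare them on the
    -- `p_n`. There, `p_n` and `m̃_n` are both primitive and killed by the counits.
    (lam_algHom_ext K fun n => by
      change Coalgebra.counit (R := K) (scaleAlgEquiv c hc (psum K n)) = counitHom K (psum K n)
      rw [scaleAlgEquiv_psum, counit_eq_counitTilde, map_smul, counitTilde_augGen, smul_zero,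
        counitHom_psum])
    (lam_algHom_ext K fun n => by
      change Algebra.TensorProduct.map (scaleAlgEquiv c hc : Lam K →ₐ[K] LamTilde K)
        (scaleAlgEquiv c hc : Lam K →ₐ[K] LamTilde K) (comulHom K (psum K n))
          = Coalgebra.comul (R := K) (scaleAlgEquiv c hc (psum K n))
      rw [scaleAlgEquiv_psum, comul_eq_comulTilde, map_smul, comulTilde_augGen, comulHom_psum,
        map_add, Algebra.TensorProduct.map_tmul, Algebra.TensorProduct.map_tmul, map_one,
        AlgEquiv.coe_toAlgHom, scaleAlgEquiv_psum, smul_add, TensorProduct.smul_tmul',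
        TensorProduct.tmul_smul])

theorem scaleAlgEquiv_mem_homogeneousTilde {n : ℕ} {f : Lam K} :
    scaleAlgEquiv c hc f ∈ homogeneousTilde K n ↔ f ∈ homogeneous K n := by
  obtain ⟨g, rfl⟩ := (psumHom_bijective K).2 f
  have h1 : augTilde K (scaleHom c g) ∈ homogeneousTilde K n
      ↔ scaleHom c g ∈ polyHomogeneous K n := by
    rw [← augMap_mem_homogeneous, homogeneousTilde]
    exact (toTilde K).injective.mem_set_image
  have h2 : psumHom K g ∈ homogeneous K n ↔ psumToAug K g ∈ polyHomogeneous K n := by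
    rw [← augMap_mem_homogeneous, ← augEquiv_apply, augEquiv_psumToAug]
  rw [scaleAlgEquiv_psumHom, h1, h2]
  -- Both memberships are now compared with the homogeneity of the polynomial `g` in the power sums,
  -- since `scaleHom c` and `psumToAug` are injective and preserve degrees.
  have h3 : scaleHom c g ∈ polyHomogeneous K n ↔ g ∈ polyHomogeneous K n :=
    ⟨mem_polyHomogeneous_of_map K (scaleHom c).toLinearMap (scaleEquiv c hc).injective
      (fun _ _ => scaleHom_mem_polyHomogeneous c), scaleHom_mem_polyHomogeneous c⟩
  have h4 : psumToAug K g ∈ polyHomogeneous K n ↔ g ∈ polyHomogeneous K n :=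
    ⟨mem_polyHomogeneous_of_map K (psumToAug K) (psumToAug_injective K)
      (fun _ _ => psumToAug_mem_polyHomogeneous K), psumToAug_mem_polyHomogeneous K⟩
  rw [h3, h4]

theorem image_scaleAlgEquiv_homogeneous (n : ℕ) :
    scaleAlgEquiv c hc '' (homogeneous K n : Set (Lam K)) = homogeneousTilde K n := by
  ext x
  obtain ⟨f, rfl⟩ := (scaleAlgEquiv c hc).surjective x
  rw [(scaleAlgEquiv c hc).injective.mem_set_image]
  exact (scaleAlgEquiv_mem_homogeneousTilde c hc).symm

/-- The hypothesis `h` says that `c`, at the weight of `T ∪ {x}`, inverts the coefficient `(-1)^|T|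
|T|!` of the first expansion. The image of that expansion is then the second one, term by term. -/
theorem scaleAlgEquiv_augMap_prod_X {V : Type*} [DecidableEq V] (w : V → ℕ+)
    (h : ∀ (x : V) (T : Finset V), x ∉ T →
      c (addWeight (w x) w T) * ((-1) ^ T.card * (T.card.factorial : K)) = 1) (S : Finset V) :
    scaleAlgEquiv c hc (augMap K (∏ x ∈ S, X (w x)))
      = augTilde K (psumToAug K (∏ x ∈ S, X (w x))) := by
  induction S using Finset.strongInduction with
  | H S ih =>
    rcases S.eq_empty_or_nonempty with rfl | ⟨x, hx⟩
    · rw [Finset.prod_empty, augMap_one, map_one, psumToAug_one, augTilde_one]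
    · obtain ⟨S, hS, rfl⟩ : ∃ S', x ∉ S' ∧ S = insert x S' :=
        ⟨S.erase x, Finset.notMem_erase x S, (Finset.insert_erase hx).symm⟩
      rw [psumToAug_prod_insert K w hS, mulP_psumToAug_prod_X, Finset.prod_insert hS,
        X_mul_prod_X K w S, map_sum, map_sum, map_sum]
      refine Finset.sum_congr rfl fun T hT => ?_
      have hxT : x ∉ T := fun h => hS (Finset.mem_powerset.1 hT h)
      -- The induction hypothesis is used for `S \ T`, a proper subset of `insert x S` even when `T`
      -- is empty.
      rw [map_smul, map_smul, augMap_mulP, map_mul, scaleAlgEquiv_psum,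
        ih _ (lt_of_le_of_lt Finset.sdiff_subset (Finset.ssubset_insert hS)), smul_mul_assoc,
        smul_smul, mul_comm _ (c _), h x T hxT, one_smul, augTilde_mul, ← augTildeAlg_X,
        augTildeAlg_apply]

end Scaling

/-! ### Colorings of cliques and of edgeless graphs. -/

section Colorings

variable (K : Type*) [Field K]

theorem psumHom_prod_X {V : Type*} (w : V → ℕ+) (S : Finset V) :
    psumHom K (∏ x ∈ S, X (w x)) = ∏ x ∈ S, psum K (w x) := by
  rw [map_prod]
  exact Finset.prod_congr rfl fun x _ => aeval_X _ _

/-- A product of power sums is the generating function of all colorings. -/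
theorem coeffL_prod_psum {V : Type*} [Fintype V] (w : V → ℕ+) (d : ℕ →₀ ℕ) :
    coeffL K d (∏ x, psum K (w x))
      = ({κ : V → ℕ | ∑ x, single (κ x) (w x : ℕ) = d}.ncard : K) := by
  classical
  have h1 : coeffL K d (∏ x, psum K (w x))
      = MvPowerSeries.coeff d (∏ x, (psum K (w x)).1) :=
    congrArg (MvPowerSeries.coeff d)
      (map_prod (symmFun K).val (fun x => psum K (w x)) Finset.univ)
  -- A term of the expanded product chooses an exponent for each vertex. It contributes exactly when
  -- each one is that of some `x_i ^ w(x)`, and then the color `i` is unique because the weight is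
  -- nonzero.
  have h2 : ∀ l : V →₀ ℕ →₀ ℕ, ∏ x, MvPowerSeries.coeff (l x) (psum K (w x)).1
      = if ∀ x, ∃ i, l x = single i (w x : ℕ) then 1 else 0 := by
    intro l
    have h3 : ∀ x, MvPowerSeries.coeff (l x) (psum K (w x)).1
        = if ∃ i, l x = single i (w x : ℕ) then 1 else 0 := fun x => by
      split_ifs with h
      · exact if_pos h
      · exact if_neg h
    simp only [h3]
    rw [Finset.prod_ite_zero]
    simp
  rw [h1, MvPowerSeries.coeff_prod]
  simp only [h2]
  rw [Finset.sum_boole, ← Set.ncard_coe_finset]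
  congr 1
  symm
  refine Set.ncard_congr
    (fun κ _ => Finsupp.equivFunOnFinite.symm fun x => single (κ x) (w x : ℕ)) ?_ ?_ ?_
  · intro κ hκ
    simp only [Finset.coe_filter, Set.mem_ofPred_eq, Finset.mem_finsuppAntidiag]
    exact ⟨⟨hκ, Finset.subset_univ _⟩, fun x => ⟨κ x, rfl⟩⟩
  · intro κ κ' _ _ h
    ext x
    have h4 := DFunLike.congr_fun h x
    exact Finsupp.single_left_injective (w x).ne_zero h4
  · intro l hl
    simp only [Finset.coe_filter, Set.mem_ofPred_eq, Finset.mem_finsuppAntidiag] at hl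
    choose κ hκ using hl.2
    refine ⟨κ, ?_, ?_⟩
    · rw [Set.mem_ofPred_eq, ← hl.1.1]
      exact Finset.sum_congr rfl fun x _ => (hκ x).symm
    · ext1 x
      exact (hκ x).symm

theorem shape_apply (d : ℕ →₀ ℕ) (n : ℕ+) :
    shape d n = (d.support.filter fun i => d i = (n : ℕ)).card := by
  classical
  rw [shape, Finsupp.finsetSum_apply, Finset.card_filter]
  refine Finset.sum_congr rfl fun i hi => ?_
  have hi' : 0 < d i := Nat.pos_of_ne_zero (by simpa using hi)
  rw [Finsupp.single_apply]
  refine if_congr ?_ rfl rfl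
  rw [← PNat.coe_inj, Nat.toPNat'_coe, if_pos hi']

theorem shape_erase {d : ℕ →₀ ℕ} {i : ℕ} {n : ℕ+} (h : d i = (n : ℕ)) :
    shape d = shape (d.erase i) + single n 1 := by
  rw [← shape_add_single _ i Finsupp.erase_same, ← h, erase_add_single]

/-- Every index `i` on the right gives the same value, and there are `shape d n` of them. This is
the factor by which the product of factorials grows when a part `n` is added. The formula is matched
with `ncard_injColorings_option`, where `i` is the color of an added vertex. -/
theorem coeffL_augMap_X_mul (n : ℕ+) (f : MvPolynomial ℕ+ K) (d : ℕ →₀ ℕ) :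
    coeffL K d (augMap K (X n * f))
      = ∑ i ∈ d.support with d i = (n : ℕ), coeffL K (d.erase i) (augMap K f) := by
  classical
  have h : ∀ i ∈ d.support.filter fun i => d i = (n : ℕ), coeffL K (d.erase i) (augMap K f)
      = multFactorial (shape d - single n 1) * coeff (shape d - single n 1) f := by
    intro i hi
    rw [coeffL_augMap, shape_erase (Finset.mem_filter.1 hi).2, add_tsub_cancel_right]
  rw [Finset.sum_congr rfl h, Finset.sum_const, ← shape_apply, coeffL_augMap, coeff_X_mul',
    nsmul_eq_mul]
  -- If `d` has no exponent `n`, the truncated subtraction is meaningless, but both sides vanish.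
  by_cases hn : shape d n = 0
  · rw [if_neg (by simpa using hn), hn, mul_zero, Nat.cast_zero, zero_mul]
  · rw [if_pos (by simpa using hn), ← mul_assoc]
    congr 1
    have hle : single n 1 ≤ shape d := by
      rw [Finsupp.single_le_iff]
      exact Nat.one_le_iff_ne_zero.2 hn
    conv_lhs => rw [← tsub_add_cancel_of_le hle]
    rw [multFactorial_add_single, Finsupp.tsub_apply, Finsupp.single_eq_same,
      Nat.sub_add_cancel (Nat.one_le_iff_ne_zero.2 hn), Nat.cast_mul]

/-- The injective colorings `κ` whose monomial `∏ v, x_{κ(v)}^{w(v)}` is `x^d`. -/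
def injColorings {V : Type*} [Fintype V] (w : V → ℕ+) (d : ℕ →₀ ℕ) : Set (V → ℕ) :=
  {κ | Function.Injective κ ∧ ∑ x, single (κ x) (w x : ℕ) = d}

/-- Every coloring is proper for the edgeless graph `⊥`, so finiteness is inherited from
`coloringsOf`. -/
theorem finite_injColorings {V : Type*} [Fintype V] (w : V → ℕ+) (d : ℕ →₀ ℕ) :
    (injColorings w d).Finite :=
  ((⟨⊥, w⟩ : WeightedGraph V).finite_coloringsOf d).subset fun _ h =>
    ⟨fun _ _ h' => h'.elim, h.2⟩

theorem sum_single_apply_of_notMem {V : Type*} [Fintype V] (w : V → ℕ+) (κ : V → ℕ) {i : ℕ}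
    (hi : ∀ x, κ x ≠ i) : (∑ x, single (κ x) (w x : ℕ)) i = 0 := by
  rw [Finsupp.finsetSum_apply]
  exact Finset.sum_eq_zero fun x _ => Finsupp.single_eq_of_ne (hi x).symm

theorem ne_of_sum_single_apply_eq_zero {V : Type*} [Fintype V] (w : V → ℕ+) (κ : V → ℕ) {i : ℕ}
    (hi : (∑ x, single (κ x) (w x : ℕ)) i = 0) (x : V) : κ x ≠ i := by
  rintro rfl
  rw [Finsupp.finsetSum_apply, Finset.sum_eq_zero_iff] at hi
  have := hi x (Finset.mem_univ x)
  rw [Finsupp.single_eq_same] at this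
  exact (w x).ne_zero this

/-- An injective coloring of `Option V` is a color of the new vertex together with an injective
coloring of `V` that avoids it. -/
theorem ncard_injColorings_option {V : Type*} [Fintype V] (w : Option V → ℕ+) (d : ℕ →₀ ℕ) :
    (injColorings w d).ncard = ∑ i ∈ d.support with d i = (w none : ℕ),
      (injColorings (fun x => w (some x)) (d.erase i)).ncard := by
  classical
  set I := d.support.filter fun i => d i = (w none : ℕ)
  have hf : ∀ i : I, Finite (injColorings (fun x => w (some x)) (d.erase i)) := fun i =>
    finite_injColorings _ _
  rw [← Finset.sum_coe_sort I fun i => (injColorings (fun x => w (some x)) (d.erase i)).ncard,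
    ← Nat.card_coe_set_eq]
  simp only [← Nat.card_coe_set_eq]
  rw [← Nat.card_sigma]
  -- If no other vertex has the color of `none`, the exponent there is exactly `w none`, and erasing
  -- it leaves the monomial of the restriction to `V`. Conversely, an erased exponent is zero, and
  -- positivity of the weights shows that the color is not used again.
  have key : ∀ κ : Option V → ℕ, κ ∈ injColorings w d ↔
      κ none ∈ I ∧ (fun x => κ (some x)) ∈ injColorings (fun x => w (some x)) (d.erase (κ none)) := by
    intro κ
    have hinj : Function.Injective κ ↔
        (∀ x, κ (some x) ≠ κ none) ∧ Function.Injective fun x => κ (some x) := by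
      constructor
      · exact fun h => ⟨fun x hx => by simpa using h hx, h.comp (Option.some_injective V)⟩
      · rintro ⟨h1, h2⟩ (_ | x) (_ | y) h
        · rfl
        · exact absurd h.symm (h1 y)
        · exact absurd h (h1 x)
        · exact congrArg some (h2 h)
    rw [injColorings, injColorings, Set.mem_ofPred_eq, Set.mem_ofPred_eq, hinj, Fintype.sum_option]
    constructor
    · rintro ⟨⟨h1, h2⟩, rfl⟩
      have h3 := sum_single_apply_of_notMem (fun x => w (some x)) (fun x => κ (some x)) h1
      have h4 : (single (κ none) (w none : ℕ)
          + ∑ x, single (κ (some x)) (w (some x) : ℕ)) (κ none) = w none := by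
        rw [Finsupp.add_apply, h3, Finsupp.single_eq_same, add_zero]
      refine ⟨?_, h2, ?_⟩
      · rw [Finset.mem_filter, Finsupp.mem_support_iff, h4]
        exact ⟨(w none).ne_zero, rfl⟩
      · rw [Finsupp.erase_add, Finsupp.erase_single, zero_add, Finsupp.erase_of_notMem_support]
        simpa using h3
    · rintro ⟨h1, h2, h3⟩
      refine ⟨⟨?_, h2⟩, ?_⟩
      · refine ne_of_sum_single_apply_eq_zero (fun x => w (some x)) (fun x => κ (some x)) ?_
        rw [h3, Finsupp.erase_same]
      · rw [h3, ← (Finset.mem_filter.1 h1).2, Finsupp.single_add_erase]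
  refine Nat.card_congr
    { toFun := fun κ => ⟨⟨κ.1 none, ((key _).1 κ.2).1⟩, ⟨_, ((key _).1 κ.2).2⟩⟩
      invFun := fun p => ⟨fun o => o.elim p.1.1 p.2.1, (key _).2 ⟨p.1.2, p.2.2⟩⟩
      left_inv := fun κ => ?_
      right_inv := fun p => rfl }
  ext (_ | x) <;> rfl

theorem ncard_injColorings_comp {V W : Type*} [Fintype V] [Fintype W] (e : V ≃ W) (w : W → ℕ+)
    (d : ℕ →₀ ℕ) : (injColorings w d).ncard = (injColorings (w ∘ e) d).ncard := by
  have hsum : ∀ κ : W → ℕ, ∑ x, single ((κ ∘ e) x) ((w ∘ e) x : ℕ)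
      = ∑ x, single (κ x) (w x : ℕ) := fun κ =>
    Equiv.sum_comp e fun x => single (κ x) (w x : ℕ)
  refine Set.ncard_congr (fun κ _ => κ ∘ e) ?_ ?_ ?_
  · exact fun κ hκ => ⟨hκ.1.comp e.injective, (hsum κ).trans hκ.2⟩
  · exact fun κ κ' _ _ h => e.surjective.injective_comp_right h
  · intro κ hκ
    have h : (κ ∘ e.symm) ∘ e = κ := by ext; simp
    refine ⟨κ ∘ e.symm, ⟨hκ.1.comp e.symm.injective, ?_⟩, h⟩
    rw [← hsum, h]
    exact hκ.2

/-- The augmented monomial symmetric function is the generating function of injective colorings. -/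
theorem coeffL_augMap_prod_X (V : Type*) [Fintype V] : ∀ (w : V → ℕ+) (d : ℕ →₀ ℕ),
    coeffL K d (augMap K (∏ x, X (w x))) = ((injColorings w d).ncard : K) := by
  classical
  -- The vertices are added one at a time: the coefficients and the numbers of injective colorings
  -- satisfy the same recursion over the color of the last vertex.
  refine Fintype.induction_empty_option (P := fun V _ => ∀ (w : V → ℕ+) (d : ℕ →₀ ℕ),
    coeffL K d (augMap K (∏ x, X (w x))) = ((injColorings w d).ncard : K)) ?_ ?_ ?_ V
  · intro V W _ e h w d
    have : Fintype V := Fintype.ofEquiv W e.symm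
    rw [ncard_injColorings_comp e, ← Equiv.prod_comp e]
    convert h (w ∘ e) d
    rfl
  · intro w d
    rw [Fintype.prod_empty, augMap_one]
    change MvPowerSeries.coeff d 1 = _
    rw [MvPowerSeries.coeff_one]
    -- Without vertices there is one coloring, and its monomial is `1`.
    split_ifs with hd
    · have : injColorings w d = Set.univ := Set.eq_univ_of_forall fun κ =>
        ⟨Function.injective_of_subsingleton κ, by rw [hd, Fintype.sum_empty]⟩
      rw [this, Set.ncard_univ, Nat.card_unique, Nat.cast_one]
    · have : injColorings w d = ∅ := Set.eq_empty_of_forall_notMem fun κ hκ =>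
        hd (by rw [← hκ.2, Fintype.sum_empty])
      rw [this, Set.ncard_empty, Nat.cast_zero]
  · intro V _ h w d
    rw [Fintype.prod_option, coeffL_augMap_X_mul, ncard_injColorings_option, Nat.cast_sum]
    exact Finset.sum_congr rfl fun i _ => h _ _

namespace WeightedGraph

variable {V : Type*} [Fintype V] (G : WeightedGraph V)

/-- In a clique, proper means injective, and `coeffL_augMap_prod_X` counts injective colorings. -/
theorem csf_of_isClique (hG : G.IsClique) : G.csf K = augMap K (∏ x, X (G.weight x)) := by
  refine lam_ext fun d => ?_
  rw [coeffL_augMap_prod_X]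
  change ((G.coloringsOf d).ncard : K) = _
  congr 2
  ext κ
  refine and_congr_left fun _ => ⟨fun h u v huv => ?_, fun h u v huv h' => ?_⟩
  · by_contra hne
    exact h u v (hG u v hne) huv
  · exact huv.ne (h h')

/-- The complement of a clique has no edges, so all colorings are proper and each vertex contributes
an independent power sum. -/
theorem csf_compl_of_isClique (hG : G.IsClique) :
    G.compl.csf K = psumHom K (∏ x, X (G.weight x)) := by
  refine lam_ext fun d => ?_
  rw [psumHom_prod_X, coeffL_prod_psum]
  change ((G.compl.coloringsOf d).ncard : K) = _
  congr 2
  ext κ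
  refine ⟨fun h => h.2, fun h => ⟨fun u v huv => ?_, h⟩⟩
  have huv' := (SimpleGraph.compl_adj _ _ _).1 huv
  exact absurd (hG u v huv'.1) huv'.2

end WeightedGraph

end Colorings

end SymmFun

end

/-! ### The main theorem. -/

theorem proposition1p6 {K : Type*} [Field K] [CharZero K] (v : ℕ+ → ℕ+) (hv : ∀ n, v n ≤ n) :
    ∃ φ : SymmFun.Lam K ≃ₐc[K] SymmFun.LamTilde K,
      (∀ n : ℕ+, φ (SymmFun.psum K n) =
        ((-1 : K) ^ ((v n : ℕ) - 1) / (((v n : ℕ) - 1).factorial : K)) •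
          SymmFun.toTilde K (SymmFun.augMonomial K (Finsupp.single n 1))) ∧
      (∀ ψ : SymmFun.Lam K →ₐ[K] SymmFun.LamTilde K,
        (∀ n : ℕ+, ψ (SymmFun.psum K n) =
          ((-1 : K) ^ ((v n : ℕ) - 1) / (((v n : ℕ) - 1).factorial : K)) •
            SymmFun.toTilde K (SymmFun.augMonomial K (Finsupp.single n 1))) →
        ∀ f : SymmFun.Lam K, ψ f = φ f) ∧
      (∀ n : ℕ, φ '' (SymmFun.homogeneous K n : Set (SymmFun.Lam K)) =
        (SymmFun.homogeneousTilde K n : Set (SymmFun.LamTilde K))) ∧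
      (∀ (V : Type*) [Fintype V] (G : SymmFun.WeightedGraph V), G.IsClique →
        (∀ (n : ℕ+) (S : Finset V), G.setWeight S = (n : ℕ) → S.card = (v n : ℕ)) →
        φ (G.csf K) = SymmFun.toTilde K (G.compl.csf K)) := by
  have hfac : ∀ k : ℕ, (k.factorial : K) ≠ 0 := fun k => Nat.cast_ne_zero.2 k.factorial_ne_zero
  have hc : ∀ n : ℕ+, (-1 : K) ^ ((v n : ℕ) - 1) / (((v n : ℕ) - 1).factorial : K) ≠ 0 := fun n =>
    div_ne_zero (pow_ne_zero _ (neg_ne_zero.2 one_ne_zero)) (hfac _)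
  refine ⟨SymmFun.scaleBialgEquiv _ hc, SymmFun.scaleAlgEquiv_psum _ hc, fun ψ hψ f => ?_,
    SymmFun.image_scaleAlgEquiv_homogeneous _ hc, fun V _ G hG hw => ?_⟩
  -- Uniqueness holds because the power sums generate `Λ`.
  · have h : ψ = (SymmFun.scaleAlgEquiv _ hc : SymmFun.Lam K →ₐ[K] SymmFun.LamTilde K) :=
      SymmFun.lam_algHom_ext K fun n =>
        (hψ n).trans (SymmFun.scaleAlgEquiv_psum _ hc n).symm
    exact DFunLike.congr_fun h f
  · classical
    rw [G.csf_of_isClique K hG, G.csf_compl_of_isClique K hG, ← SymmFun.augEquiv_psumToAug]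
    refine SymmFun.scaleAlgEquiv_augMap_prod_X _ hc G.weight (fun x T hx => ?_) Finset.univ
    -- The hypothesis on induced subgraphs, applied to the vertex set `insert x T`, gives `T.card +
    -- 1` as the value of `v` at its weight.
    have h1 := hw (SymmFun.addWeight (G.weight x) G.weight T) (insert x T)
      (Finset.sum_insert hx)
    rw [Finset.card_insert_of_notMem hx] at h1
    -- The scalar is thus `(-1)^|T| / |T|!`, whose product with `(-1)^|T| |T|!` is `1`.
    rw [← h1, Nat.add_sub_cancel, div_mul_eq_mul_div, ← mul_assoc, ← mul_pow, neg_mul_neg,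
      one_mul, one_pow, one_mul, div_self (hfac _)]
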